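/- Let $d\in\mathbb N$, $\mathbb T^d=(\mathbb R/\mathbb Z)^d$, $X=\mathbb T^d\times\mathbb R^d\times(0,\infty)$ with points $z=(x,v,\theta)$, and let $\phi,\zeta:\mathbb T^d\to\mathbb R$ be Lipschitz continuous. For a nonnegative Radon measure $\mu$ on $X$ with compact support put $$F[\mu](x,v,\theta)=\int_X\phi(x-x_*)\Big(\frac{v_*}{\theta_*}-\frac v\theta\Big)\mu(dz_*),\qquad G[\mu](x,\theta)=\int_X\zeta(x-x_*)\Big(\frac1\theta-\frac1{\theta_*}\Big)\mu(dz_*).$$ A family $(\mu_t)_{t\in[0,T]}$ of nonnegative Radon measures on $X$ with $\operatorname{ess\,sup}_t\mu_t(X)<\infty$ is a measure-valued solution of the kinetic thermomechanical Cucker–Smale equation $$\partial_tf+v\cdot\nabla_xf+\nabla_v\cdot(F[f]f)+\partial_\theta(G[f]f)=0$$ if (i) $t\mapsto\int_X g\,d\mu_t$ is continuous on $[0,T]$ for every $g\in C_0(X)$, and (ii) for every $C^1$ function $g$ with compact support in $[0,T)\times X$ and every $t\in[0,T)$, $$\int_X g(t,\cdot)\,d\mu_t-\int_X g(0,\cdot)\,d\mu_0=\int_0^t\int_X\big(\partial_sg+v\cdot\nabla_xg+F[\mu_s]\cdot\nabla_vg+G[\mu_s]\,\partial_\theta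 g\big)\,d\mu_s\,ds.$$ The bounded Lipschitz distance is $d(\mu,\nu)=\sup_{g\in\Omega}\big|\int_Xg\,d\mu-\int_Xg\,d\nu\big|$, where $\Omega$ is the set of $g:X\to\mathbb R$ with $\|g\|_{L^\infty}\le1$ and Lipschitz constant at most $1$ (for the Euclidean product distance on $X$). Let $T,P_T,\theta_m^0,\theta_M^0>0$ and $M\ge0$. Then there is a constant $C_T>0$, depending only on $d,\phi,\zeta,T,P_T,\theta_m^0,\theta_M^0,M$, such that for any two measure-valued solutions $\mu,\nu$ on $[0,T]$ with $\mu_0(X),\nu_0(X)\le M$ and $$\operatorname{supp}\mu_t,\ \operatorname{supp}\nu_t\subset\mathbb T^d\times\overline{B_{P_T}(0)}\times[\theta_m^0,\theta_M^0]\qquad\text{for all }t\in[0,T],$$ one has $$d(\mu_t,\nu_t)\le C_T\,d(\mu_0,\nu_0)\qquad\text{for all }t\in[0,T].$$ -/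

import Mathlib

open MeasureTheory Set
open scoped NNReal ENNReal ZeroAtInfty

noncomputable section

namespace TCS

/-- The phase space `X = 𝕋^d × ℝ^d × ℝ_+` of positions, velocities and (positive) temperatures,
with `𝕋^d = (ℝ/ℤ)^d` and `ℝ_+ = (0, ∞)`. -/
abbrev Phase (d : ℕ) : Type :=
  UnitAddTorus (Fin d) × EuclideanSpace ℝ (Fin d) × Ioi (0 : ℝ)

/-- The covering map `ℝ^d → 𝕋^d`. -/
def toTorus {d : ℕ} (y : EuclideanSpace ℝ (Fin d)) : UnitAddTorus (Fin d) :=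
  fun i => (y i : UnitAddCircle)

/-- The Euclidean product distance on `X`; on the torus it is the flat distance, since
`‖x i - x' i‖` is the distance of `x i` and `x' i` on the circle `ℝ/ℤ`. -/
def phaseDist {d : ℕ} (z z' : Phase d) : ℝ :=
  Real.sqrt ((∑ i, ‖z.1 i - z'.1 i‖ ^ 2) + ‖z.2.1 - z'.2.1‖ ^ 2
    + ((z.2.2 : ℝ) - (z'.2.2 : ℝ)) ^ 2)

/-- The class `Ω` of functions on `X` that are bounded by `1` and `1`-Lipschitz. -/
def blClass (d : ℕ) : Set (Phase d → ℝ) :=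
  {g | (∀ z, |g z| ≤ 1) ∧ ∀ z z', |g z - g z'| ≤ phaseDist z z'}

/-- The bounded Lipschitz distance of two (finite) measures on `X`. -/
def blDist {d : ℕ} (μ ν : Measure (Phase d)) : ℝ≥0∞ :=
  ⨆ g ∈ blClass d, ENNReal.ofReal |∫ z, g z ∂μ - ∫ z, g z ∂ν|

/-- `F[μ](x, v, θ) = ∫ φ(x - x_*) (v_* / θ_* - v / θ) μ(dz_*)`. -/
def force {d : ℕ} (φ : UnitAddTorus (Fin d) → ℝ) (μ : Measure (Phase d)) (z : Phase d) :
    EuclideanSpace ℝ (Fin d) :=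
  ∫ w, φ (z.1 - w.1) • ((w.2.2 : ℝ)⁻¹ • w.2.1 - (z.2.2 : ℝ)⁻¹ • z.2.1) ∂μ

/-- `G[μ](x, θ) = ∫ ζ(x - x_*) (1 / θ - 1 / θ_*) μ(dz_*)`. -/
def heating {d : ℕ} (ζ : UnitAddTorus (Fin d) → ℝ) (μ : Measure (Phase d)) (z : Phase d) : ℝ :=
  ∫ w, ζ (z.1 - w.1) * ((z.2.2 : ℝ)⁻¹ - (w.2.2 : ℝ)⁻¹) ∂μ

/-- A function of time and phase, written in the coordinates `(s, x, v, θ)` with `x` in the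
universal cover `ℝ^d` of the torus. Only its values at `θ > 0` matter. -/
def inCoords {d : ℕ} (g : ℝ → Phase d → ℝ)
    (q : ℝ × EuclideanSpace ℝ (Fin d) × EuclideanSpace ℝ (Fin d) × ℝ) : ℝ :=
  if h : 0 < q.2.2.2 then g q.1 (toTorus q.2.1, q.2.2.1, ⟨q.2.2.2, h⟩) else 0

/-- `C¹` test functions with compact support in `(-∞, T) × X`. Their restrictions to `[0, T) × X`
are exactly the `C¹` functions with compact support in `[0, T) × X`. -/
structure IsTest {d : ℕ} (T : ℝ) (g : ℝ → Phase d → ℝ) : Prop where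
  contDiffOn : ContDiffOn ℝ 1 (inCoords g) {q | 0 < q.2.2.2}
  hasCompactSupport : HasCompactSupport (Function.uncurry g)
  tsupport_subset : tsupport (Function.uncurry g) ⊆ Iio T ×ˢ univ

/-- The time derivative `∂_s g`. -/
def dTime {d : ℕ} (g : ℝ → Phase d → ℝ) (s : ℝ) (z : Phase d) : ℝ :=
  deriv (fun r => g r z) s

/-- The gradient `∇_x g` in the position variable on the torus. -/
def gradPos {d : ℕ} (g : ℝ → Phase d → ℝ) (s : ℝ) (z : Phase d) : EuclideanSpace ℝ (Fin d) :=
  gradient (fun y : EuclideanSpace ℝ (Fin d) => g s (z.1 + toTorus y, z.2)) 0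

/-- The gradient `∇_v g` in the velocity variable. -/
def gradVel {d : ℕ} (g : ℝ → Phase d → ℝ) (s : ℝ) (z : Phase d) : EuclideanSpace ℝ (Fin d) :=
  gradient (fun w : EuclideanSpace ℝ (Fin d) => g s (z.1, w, z.2.2)) z.2.1

/-- The derivative `∂_θ g` in the temperature variable. -/
def dTemp {d : ℕ} (g : ℝ → Phase d → ℝ) (s : ℝ) (z : Phase d) : ℝ :=
  deriv (fun r : ℝ => if h : 0 < r then g s (z.1, z.2.1, ⟨r, h⟩) else 0) (z.2.2 : ℝ)

/-- `t ↦ μ t`, `t ∈ [0, T]`, is a measure-valued solution, with initial measure `μ 0`, of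
`∂_t f + v · ∇_x f + ∇_v · (F[f] f) + ∂_θ (G[f] f) = 0`. Values of `μ` at times outside `[0, T]`
are irrelevant. -/
structure IsMeasureValuedSolution {d : ℕ} (φ ζ : UnitAddTorus (Fin d) → ℝ) (T : ℝ)
    (μ : ℝ → Measure (Phase d)) : Prop where
  /-- each `μ t` is a Radon measure -/
  radon : ∀ t ∈ Icc 0 T, (μ t).Regular
  /-- the total mass is essentially bounded in time -/
  essBounded : ∃ K : ℝ≥0, ∀ᵐ t ∂(volume.restrict (Icc 0 T)), μ t univ ≤ K
  /-- weak continuity in time, tested on continuous functions that vanish at infinity -/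
  weaklyContinuous : ∀ g : C₀(Phase d, ℝ), ContinuousOn (fun t => ∫ z, g z ∂(μ t)) (Icc 0 T)
  /-- the equation in the sense of distributions -/
  equation : ∀ g : ℝ → Phase d → ℝ, IsTest T g → ∀ t ∈ Ico 0 T,
    ∫ z, g t z ∂(μ t) - ∫ z, g 0 z ∂(μ 0) =
      ∫ s in (0 : ℝ)..t, ∫ z, (dTime g s z + inner ℝ z.2.1 (gradPos g s z)
        + inner ℝ (force φ (μ s) z) (gradVel g s z)
        + heating ζ (μ s) z * dTemp g s z) ∂(μ s)

/-- The set `𝕋^d × B_P(0) × [θm, θM]`, with the closed ball. -/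
def box (d : ℕ) (P θm θM : ℝ) : Set (Phase d) :=
  {z | z.2.1 ∈ Metric.closedBall 0 P ∧ (z.2.2 : ℝ) ∈ Icc θm θM}

end TCS

end

/-
A measurable section of the covering `ℝ^d → 𝕋^d` lifts the measures to a vector space. Since their
supports stay in a fixed compact set on which `θ` is bounded below, the coefficients may be
truncated to bounded Lipschitz maps, and the lifted measures solve a mean-field continuity equation
tested on periodic functions.

Measure the distance of two such solutions on the functions bounded by `1`, `1`-Lipschitz and with
`A`-Lipschitz derivative. To first order in the time step, a solution is transported by one Euler
step along a mollified field, and composition with this step almost preserves the class of test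
functions. The resulting differential inequality has a rate independent of `A` once the
mollification scale is tied to `A`; Gronwall's inequality and the limit of vanishing scale then
give stability in the bounded Lipschitz distance, without following characteristics.
-/

open Filter Topology
open scoped Convolution Manifold ContDiff

namespace TCS

section BoundedLipschitz

variable {V : Type*} [NormedAddCommGroup V]
variable {W : Type*} [NormedAddCommGroup W]

/-- `f` is bounded by `B`, is `L`-Lipschitz, and is periodic with respect to every vector of `Λ`.
With `Λ = ℤ^d × 0` these are the bounded Lipschitz functions on `𝕋^d × ℝ^d × ℝ`, lifted to the
universal cover. -/
structure IsBL (Λ : Set V) (B L : ℝ≥0) (f : V → W) : Prop where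
  norm_le : ∀ x, ‖f x‖ ≤ B
  lipschitz : LipschitzWith L f
  periodic : ∀ p ∈ Λ, Function.Periodic f p

/-- The test functions of the bounded Lipschitz distance. -/
def blBall (Λ : Set V) : Set (V → ℝ) := {f | IsBL Λ 1 1 f}

variable {Λ : Set V} {B L B' L' : ℝ≥0} {f : V → W}

theorem IsBL.continuous (hf : IsBL Λ B L f) : Continuous f := hf.lipschitz.continuous

theorem IsBL.norm_sub_le (hf : IsBL Λ B L f) (x y : V) : ‖f x - f y‖ ≤ L * ‖x - y‖ :=
  hf.lipschitz.norm_sub_le x y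

theorem IsBL.mono (hf : IsBL Λ B L f) (hB : B ≤ B') (hL : L ≤ L') : IsBL Λ B' L' f where
  norm_le x := (hf.norm_le x).trans hB
  lipschitz := hf.lipschitz.weaken hL
  periodic := hf.periodic

theorem IsBL.add {g : V → W} (hf : IsBL Λ B L f) (hg : IsBL Λ B' L' g) :
    IsBL Λ (B + B') (L + L') (fun x => f x + g x) where
  norm_le x := norm_add_le_of_le (hf.norm_le x) (hg.norm_le x)
  lipschitz := hf.lipschitz.add hg.lipschitz
  periodic p hp := (hf.periodic p hp).add (hg.periodic p hp)

theorem IsBL.integrable [MeasurableSpace V] [BorelSpace V] [SecondCountableTopologyEither V W]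
    (hf : IsBL Λ B L f) (m : Measure V) [IsFiniteMeasure m] : Integrable f m :=
  .of_bound hf.continuous.aestronglyMeasurable B (Eventually.of_forall hf.norm_le)

theorem IsBL.const_smul [NormedSpace ℝ W] (hf : IsBL Λ B L f) (c : ℝ≥0) :
    IsBL Λ (c * B) (c * L) (fun x => (c : ℝ) • f x) where
  norm_le x := by
    rw [norm_smul, NNReal.norm_eq, NNReal.coe_mul]
    gcongr
    exact hf.norm_le x
  lipschitz := by
    have h := (lipschitzWith_smul (c : ℝ)).comp hf.lipschitz
    rwa [NNReal.nnnorm_eq] at h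
  periodic p hp := (hf.periodic p hp).comp _

theorem IsBL.comp_euler [NormedSpace ℝ V] {b l δ : ℝ≥0} {c : V → V}
    (hf : IsBL Λ B L f) (hc : IsBL Λ b l c) :
    IsBL Λ B (L * (1 + δ * l)) (fun z => f (z + (δ : ℝ) • c z)) where
  norm_le _ := hf.norm_le _
  lipschitz := hf.lipschitz.comp (LipschitzWith.id.add (hc.const_smul δ).lipschitz)
  periodic p hp z := by
    simp only [hc.periodic p hp z, add_right_comm z p, (hf.periodic p hp) _]

variable [NormedSpace ℝ W]

theorem IsBL.clm_comp {W' : Type*} [NormedAddCommGroup W'] [NormedSpace ℝ W']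
    (hf : IsBL Λ B L f) (ℓ : W →L[ℝ] W') : IsBL Λ (‖ℓ‖₊ * B) (‖ℓ‖₊ * L) (fun x => ℓ (f x)) where
  norm_le x := ℓ.le_opNorm_of_le (hf.norm_le x)
  lipschitz := ℓ.lipschitz.comp hf.lipschitz
  periodic p hp := (hf.periodic p hp).comp _

theorem IsBL.bilin {W₁ W₂ : Type*} [NormedAddCommGroup W₁] [NormedSpace ℝ W₁]
    [NormedAddCommGroup W₂] [NormedSpace ℝ W₂] (ℓ : W₁ →L[ℝ] W₂ →L[ℝ] W) (hℓ : ‖ℓ‖ ≤ 1)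
    {f : V → W₁} {g : V → W₂} (hf : IsBL Λ B L f) (hg : IsBL Λ B' L' g) :
    IsBL Λ (B * B') (B * L' + L * B') (fun x => ℓ (f x) (g x)) := by
  have bound (u : W₁) (w : W₂) : ‖ℓ u w‖ ≤ ‖u‖ * ‖w‖ := by
    simpa using ℓ.le_of_opNorm₂_le_of_le hℓ le_rfl le_rfl
  refine ⟨fun x => ?_, LipschitzWith.of_dist_le_mul fun x y => ?_,
    fun p hp x => by rw [hf.periodic p hp x, hg.periodic p hp x]⟩
  · exact (bound _ _).trans (mul_le_mul (hf.norm_le x) (hg.norm_le x) (norm_nonneg _) B.2)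
  · have split : ℓ (f x) (g x) - ℓ (f y) (g y) = ℓ (f x) (g x - g y) + ℓ (f x - f y) (g y) := by
      simp
    rw [dist_eq_norm, dist_eq_norm, split]
    calc ‖ℓ (f x) (g x - g y) + ℓ (f x - f y) (g y)‖
        ≤ ‖f x‖ * ‖g x - g y‖ + ‖f x - f y‖ * ‖g y‖ :=
          norm_add_le_of_le (bound _ _) (bound _ _)
      _ ≤ B * (L' * ‖x - y‖) + L * ‖x - y‖ * B' := by
          gcongr
          exacts [hf.norm_le x, hg.norm_sub_le x y, hf.norm_sub_le x y, hg.norm_le y]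
      _ = ↑(B * L' + L * B') * ‖x - y‖ := by push_cast; ring

theorem IsBL.integral {α : Type*} [MeasurableSpace α] {m : Measure α} {a : α → ℝ} {C : ℝ≥0}
    {k : V → α → W} (hk : ∀ z, Integrable (k z) m) (ha : Integrable a m) (hC : ∫ w, a w ∂m ≤ C)
    (norm_le : ∀ z w, ‖k z w‖ ≤ a w * B)
    (norm_sub_le : ∀ z z' w, ‖k z w - k z' w‖ ≤ a w * (L * ‖z - z'‖))
    (periodic : ∀ w, ∀ p ∈ Λ, Function.Periodic (k · w) p) :
    IsBL Λ (C * B) (C * L) (fun z => ∫ w, k z w ∂m) where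
  norm_le z := calc
    ‖∫ w, k z w ∂m‖ ≤ ∫ w, a w * B ∂m :=
      norm_integral_le_of_norm_le (ha.mul_const _) (Eventually.of_forall (norm_le z))
    _ ≤ ↑(C * B) := by
      rw [integral_mul_const, NNReal.coe_mul]
      gcongr
  lipschitz := LipschitzWith.of_dist_le_mul fun z z' => calc
    dist (∫ w, k z w ∂m) (∫ w, k z' w ∂m) = ‖∫ w, (k z w - k z' w) ∂m‖ := by
      rw [dist_eq_norm, integral_sub (hk z) (hk z')]
    _ ≤ ∫ w, a w * (L * ‖z - z'‖) ∂m :=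
      norm_integral_le_of_norm_le (ha.mul_const _) (Eventually.of_forall (norm_sub_le z z'))
    _ ≤ ↑(C * L) * dist z z' := by
      rw [integral_mul_const, dist_eq_norm, NNReal.coe_mul, mul_assoc]
      gcongr
  periodic p hp z := integral_congr_ae (Eventually.of_forall fun w => periodic w p hp z)

theorem IsBL.convolution [NormedSpace ℝ V] [MeasurableSpace V] [BorelSpace V]
    [SecondCountableTopology V] {W₁ W₂ : Type*} [NormedAddCommGroup W₁]
    [NormedSpace ℝ W₁] [NormedAddCommGroup W₂] [NormedSpace ℝ W₂] {m : Measure V}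
    [IsFiniteMeasureOnCompacts m] (ℓ : W₁ →L[ℝ] W₂ →L[ℝ] W) (hℓ : ‖ℓ‖ ≤ 1) {g : V → W₁}
    (hg : Continuous g) (hgs : HasCompactSupport g) {C : ℝ≥0} (hC : ∫ u, ‖g u‖ ∂m ≤ C)
    {f : V → W₂} (hf : IsBL Λ B L f) : IsBL Λ (C * B) (C * L) (g ⋆[ℓ, m] f) := by
  have bound (u : W₁) (w : W₂) : ‖ℓ u w‖ ≤ ‖u‖ * ‖w‖ := by
    simpa using ℓ.le_of_opNorm₂_le_of_le hℓ le_rfl le_rfl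
  have hgi : Integrable g m := hg.integrable_of_hasCompactSupport hgs
  refine IsBL.integral (fun z =>
    hgs.convolutionExists_left_of_continuous_right ℓ hgi.locallyIntegrable hf.continuous z)
    hgi.norm hC (fun z w => (bound _ _).trans ?_) (fun z z' w => ?_) fun w p hp z => ?_
  · gcongr
    exact hf.norm_le _
  · rw [← map_sub]
    refine (bound _ _).trans ?_
    gcongr
    simpa only [sub_sub_sub_cancel_right] using hf.norm_sub_le (z - w) (z' - w)
  · simp only [add_sub_right_comm, (hf.periodic p hp) (z - w)]

end BoundedLipschitz

section Mollification

variable {V : Type*} [NormedAddCommGroup V] [NormedSpace ℝ V]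
variable {W : Type*} [NormedAddCommGroup W] [NormedSpace ℝ W]

/-- Bounded Lipschitz periodic functions whose derivative is `A`-Lipschitz. -/
structure IsC11 (Λ : Set V) (B L A : ℝ≥0) (f : V → W) : Prop extends IsBL Λ B L f where
  differentiable : Differentiable ℝ f
  lipschitz_fderiv : LipschitzWith A (fderiv ℝ f)

/-- The members of `blBall Λ` whose derivative is `A`-Lipschitz. -/
def c11Ball (Λ : Set V) (A : ℝ≥0) : Set (V → ℝ) := {f | IsC11 Λ 1 1 A f}

theorem c11Ball_subset_blBall (Λ : Set V) (A : ℝ≥0) : c11Ball Λ A ⊆ blBall Λ :=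
  fun _ hf => hf.toIsBL

variable {Λ : Set V} {B L A : ℝ≥0} {f : V → W}

theorem isC11_const (c : W) : IsC11 Λ ‖c‖₊ 0 0 (fun _ => c) where
  norm_le _ := le_rfl
  lipschitz := .const c
  periodic _ _ _ := rfl
  differentiable := differentiable_const c
  lipschitz_fderiv := by
    rw [fderiv_fun_const]
    exact .const 0

theorem IsC11.mono {B' L' A' : ℝ≥0} (hf : IsC11 Λ B L A f) (hB : B ≤ B') (hL : L ≤ L')
    (hA : A ≤ A') : IsC11 Λ B' L' A' f where
  toIsBL := hf.toIsBL.mono hB hL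
  differentiable := hf.differentiable
  lipschitz_fderiv := hf.lipschitz_fderiv.weaken hA

theorem IsC11.isBL_fderiv (hf : IsC11 Λ B L A f) : IsBL Λ L A (fderiv ℝ f) where
  norm_le _ := norm_fderiv_le_of_lipschitz ℝ hf.lipschitz
  lipschitz := hf.lipschitz_fderiv
  periodic p hp x := by
    rw [← fderiv_comp_add_right]
    exact congrArg (fderiv ℝ · x) (funext (hf.periodic p hp))

theorem IsC11.isBL_fderiv_apply {b l : ℝ≥0} {c : V → V} (hf : IsC11 Λ B L A f) (hc : IsBL Λ b l c) :
    IsBL Λ (L * b) (L * l + A * b) (fun z => fderiv ℝ f z (c z)) :=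
  hf.isBL_fderiv.bilin (.id ℝ (V →L[ℝ] W)) ContinuousLinearMap.norm_id_le hc

theorem IsC11.const_smul (hf : IsC11 Λ B L A f) (c : ℝ≥0) :
    IsC11 Λ (c * B) (c * L) (c * A) (fun x => (c : ℝ) • f x) where
  toIsBL := hf.toIsBL.const_smul c
  differentiable := hf.differentiable.const_smul (c : ℝ)
  lipschitz_fderiv := by
    rw [funext fun x => fderiv_fun_const_smul (hf.differentiable x) (c : ℝ)]
    exact (hf.isBL_fderiv.const_smul c).lipschitz

theorem IsC11.contDiff (hf : IsC11 Λ B L A f) : ContDiff ℝ 1 f :=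
  contDiff_one_iff_fderiv.2 ⟨hf.differentiable, hf.isBL_fderiv.continuous⟩

theorem IsC11.norm_add_sub_sub_fderiv_le (hf : IsC11 Λ B L A f) (x u : V) :
    ‖f (x + u) - f x - fderiv ℝ f x u‖ ≤ A * ‖u‖ ^ 2 := by
  have mean_value := (convex_closedBall x ‖u‖).norm_image_sub_le_of_norm_hasFDerivWithin_le'
    (f' := fderiv ℝ f) (φ := fderiv ℝ f x) (C := A * ‖u‖) (x := x) (y := x + u)
    (fun z _ => (hf.differentiable z).hasFDerivAt.hasFDerivWithinAt)
    (fun z hz => (hf.isBL_fderiv.norm_sub_le z x).trans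
      (by gcongr; rwa [← mem_closedBall_iff_norm]))
    (Metric.mem_closedBall_self (norm_nonneg _)) (by simp)
  rw [add_sub_cancel_left] at mean_value
  exact mean_value.trans_eq (by ring)

theorem IsC11.comp_euler {b l a δ : ℝ≥0} {c : V → V} (hf : IsC11 Λ B L A f)
    (hc : IsC11 Λ b l a c) :
    IsC11 Λ B (L * (1 + δ * l)) (L * (δ * a) + A * (1 + δ * l) * (1 + δ * l))
      (fun z => f (z + (δ : ℝ) • c z)) := by
  have step (z : V) : HasFDerivAt (fun z => z + (δ : ℝ) • c z)
      (.id ℝ V + (δ : ℝ) • fderiv ℝ c z) z :=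
    (hasFDerivAt_id z).add ((hc.differentiable z).hasFDerivAt.const_smul (δ : ℝ))
  have chain (z : V) := ((hf.differentiable _).hasFDerivAt (x := z + (δ : ℝ) • c z)).comp z (step z)
  have step_isBL : IsBL Λ (1 + δ * l) (δ * a)
      (fun z => ContinuousLinearMap.id ℝ V + (δ : ℝ) • fderiv ℝ c z) :=
    ((isC11_const _).add (hc.isBL_fderiv.const_smul δ)).mono
      (by gcongr; exact ContinuousLinearMap.norm_id_le) (by simp)
  refine ⟨hf.toIsBL.comp_euler hc.toIsBL, fun z => (chain z).differentiableAt, ?_⟩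
  rw [show fderiv ℝ (fun z => f (z + (δ : ℝ) • c z)) = _ from funext fun z => (chain z).fderiv]
  exact ((hf.isBL_fderiv.comp_euler hc.toIsBL).bilin (.compL ℝ V V W)
    (ContinuousLinearMap.norm_compL_le ..) step_isBL).lipschitz

variable [FiniteDimensional ℝ V] [MeasurableSpace V] [BorelSpace V]

/-- The `L¹` norm of the gradient of the mollifier `ρ`. Mollification turns an `L`-Lipschitz
function into one whose derivative is `L * mollConst ρ`-Lipschitz. -/
noncomputable def mollConst (ρ : ContDiffBump (0 : V)) : ℝ≥0 :=
  ⟨∫ u, ‖fderiv ℝ (ρ.normed Measure.addHaar) u‖ ∂Measure.addHaar,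
    integral_nonneg fun _ => norm_nonneg _⟩

theorem IsBL.exists_isC11_near [CompleteSpace W] (hf : IsBL Λ B L f) (ρ : ContDiffBump (0 : V)) :
    ∃ g : V → W, IsC11 Λ B L (L * mollConst ρ) g ∧ ∀ x, ‖g x - f x‖ ≤ L * ρ.rOut := by
  set m : Measure V := Measure.addHaar
  have r_smooth : ContDiff ℝ 1 (ρ.normed m) := ρ.contDiff_normed
  have r_supp : HasCompactSupport (ρ.normed m) := ρ.hasCompactSupport_normed
  have r_mass : ∫ u, ‖ρ.normed m u‖ ∂m ≤ (1 : ℝ≥0) := by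
    simp [Real.norm_of_nonneg (ρ.nonneg_normed _), ρ.integral_normed]
  have smul_le : ‖(.lsmul ℝ ℝ : ℝ →L[ℝ] W →L[ℝ] W)‖ ≤ 1 := ContinuousLinearMap.opNorm_lsmul_le
  have deriv_conv (x : V) := r_supp.hasFDerivAt_convolution_left (.lsmul ℝ ℝ) r_smooth
    (hf.continuous.locallyIntegrable (μ := m)) x
  have deriv_isBL := hf.convolution (m := m) (C := mollConst ρ)
    ((ContinuousLinearMap.lsmul ℝ ℝ : ℝ →L[ℝ] W →L[ℝ] W).precompL V)
    ((ContinuousLinearMap.norm_precompL_le V _).trans smul_le)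
    (r_smooth.continuous_fderiv one_ne_zero) (r_supp.fderiv ℝ) le_rfl
  refine ⟨ρ.normed m ⋆[.lsmul ℝ ℝ, m] f, ⟨?_, fun x => (deriv_conv x).differentiableAt, ?_⟩,
    fun x => ?_⟩
  · exact (hf.convolution _ smul_le r_smooth.continuous r_supp r_mass).mono
      (one_mul B).le (one_mul L).le
  · rw [funext fun x => (deriv_conv x).fderiv, mul_comm]
    exact deriv_isBL.lipschitz
  · rw [← dist_eq_norm]
    refine ρ.dist_normed_convolution_le hf.continuous.aestronglyMeasurable fun y hy => ?_
    exact hf.lipschitz.dist_le_mul_of_le (Metric.mem_ball.1 hy).le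

end Mollification

section DualDistance

variable {V : Type*} [MeasurableSpace V]

/-- The distance of two measures tested on the class `𝓕`. -/
noncomputable def dualDist (𝓕 : Set (V → ℝ)) (m n : Measure V) : ℝ :=
  ⨆ f : 𝓕, |∫ z, f.1 z ∂m - ∫ z, f.1 z ∂n|

variable {𝓕 : Set (V → ℝ)} {m n : Measure V}

theorem dualDist_nonneg : 0 ≤ dualDist 𝓕 m n := Real.iSup_nonneg fun _ => abs_nonneg _

theorem dualDist_le {D : ℝ} (hD : 0 ≤ D) (h : ∀ f ∈ 𝓕, |∫ z, f z ∂m - ∫ z, f z ∂n| ≤ D) :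
    dualDist 𝓕 m n ≤ D :=
  Real.iSup_le (fun f => h f.1 f.2) hD

theorem dualDist_comm : dualDist 𝓕 m n = dualDist 𝓕 n m := by
  simp only [dualDist, abs_sub_comm]

variable [IsFiniteMeasure m] [IsFiniteMeasure n]

theorem abs_integral_sub_integral_le {f g : V → ℝ} {ε : ℝ} (hf : Integrable f m)
    (hg : Integrable g m) (h : ∀ z, |f z - g z| ≤ ε) :
    |∫ z, f z ∂m - ∫ z, g z ∂m| ≤ ε * m.real univ := by
  rw [← integral_sub hf hg]
  exact norm_integral_le_of_norm_le_const (f := fun z => f z - g z) (Eventually.of_forall h)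

variable [NormedAddCommGroup V] {Λ : Set V}

theorem le_dualDist (h𝓕 : 𝓕 ⊆ blBall Λ) {f : V → ℝ} (hf : f ∈ 𝓕) :
    |∫ z, f z ∂m - ∫ z, f z ∂n| ≤ dualDist 𝓕 m n := by
  refine le_ciSup (f := fun f : 𝓕 => |∫ z, f.1 z ∂m - ∫ z, f.1 z ∂n|)
    ⟨m.real univ + n.real univ, ?_⟩ ⟨f, hf⟩
  rintro _ ⟨g, rfl⟩
  have integral_le (p : Measure V) [IsFiniteMeasure p] : |∫ z, g.1 z ∂p| ≤ p.real univ := by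
    simpa using norm_integral_le_of_norm_le_const (Eventually.of_forall (h𝓕 g.2).norm_le)
  exact (abs_sub _ _).trans (add_le_add (integral_le m) (integral_le n))

theorem abs_integral_sub_le_mul_dualDist (h𝓕 : 𝓕 ⊆ blBall Λ) {c : ℝ≥0} (hc : c ≠ 0)
    {f : V → ℝ} (hf : (fun z => ((c⁻¹ : ℝ≥0) : ℝ) • f z) ∈ 𝓕) :
    |∫ z, f z ∂m - ∫ z, f z ∂n| ≤ c * dualDist 𝓕 m n := by
  have hc' : (0 : ℝ) < c := NNReal.coe_pos.2 hc.bot_lt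
  have scaled := le_dualDist (m := m) (n := n) h𝓕 hf
  rwa [integral_smul, integral_smul, ← smul_sub, smul_eq_mul, abs_mul, NNReal.abs_eq,
    NNReal.coe_inv, inv_mul_le_iff₀ hc'] at scaled

theorem dualDist_triangle (h𝓕 : 𝓕 ⊆ blBall Λ) (p : Measure V) [IsFiniteMeasure p] :
    dualDist 𝓕 m n ≤ dualDist 𝓕 m p + dualDist 𝓕 p n :=
  dualDist_le (add_nonneg dualDist_nonneg dualDist_nonneg) fun _ hf =>
    (abs_sub_le _ _ _).trans (add_le_add (le_dualDist h𝓕 hf) (le_dualDist h𝓕 hf))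

theorem dualDist_mono {𝓖 : Set (V → ℝ)} (h : 𝓕 ⊆ 𝓖) (h𝓖 : 𝓖 ⊆ blBall Λ) :
    dualDist 𝓕 m n ≤ dualDist 𝓖 m n :=
  dualDist_le dualDist_nonneg fun _ hf => le_dualDist h𝓖 (h hf)

theorem IsBL.abs_integral_sub_le {B L : ℝ≥0} {f : V → ℝ} (hf : IsBL Λ B L f) :
    |∫ z, f z ∂m - ∫ z, f z ∂n| ≤ (B + L) * dualDist (blBall Λ) m n := by
  rcases eq_or_ne (B + L) 0 with h0 | h0
  · obtain ⟨rfl, rfl⟩ := add_eq_zero.1 h0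
    have f_zero (z : V) : f z = 0 := by simpa using hf.norm_le z
    simp [f_zero]
  · rw [← NNReal.coe_add]
    refine abs_integral_sub_le_mul_dualDist subset_rfl h0 ((hf.const_smul _).mono ?_ ?_) <;>
    · rw [inv_mul_le_one₀ h0.bot_lt]
      simp

theorem dualDist_blBall_le [NormedSpace ℝ V] [FiniteDimensional ℝ V] [BorelSpace V] {M : ℝ}
    (hm : m.real univ ≤ M) (hn : n.real univ ≤ M) (ρ : ContDiffBump (0 : V)) :
    dualDist (blBall Λ) m n ≤ dualDist (c11Ball Λ (mollConst ρ)) m n + 2 * (ρ.rOut * M) := by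
  have hM : 0 ≤ ρ.rOut * M := mul_nonneg ρ.rOut_pos.le (measureReal_nonneg.trans hm)
  have hd : 0 ≤ dualDist (c11Ball Λ (mollConst ρ)) m n := dualDist_nonneg
  refine dualDist_le (by linarith) fun f hf => ?_
  obtain ⟨g, hg, g_near⟩ := IsBL.exists_isC11_near hf ρ
  rw [one_mul] at hg
  have near (p : Measure V) [IsFiniteMeasure p] (hp : p.real univ ≤ M) :
      |∫ z, g z ∂p - ∫ z, f z ∂p| ≤ ρ.rOut * M :=
    (abs_integral_sub_integral_le (hg.integrable p) (IsBL.integrable hf p)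
      (by simpa using g_near)).trans (mul_le_mul_of_nonneg_left hp ρ.rOut_pos.le)
  have test := le_dualDist (m := m) (n := n) (c11Ball_subset_blBall ..) hg
  grind [near m hm, near n hn]

theorem dualDist_blBall_le_of_tendsto [NormedSpace ℝ V] [FiniteDimensional ℝ V] [BorelSpace V]
    {G : ℝ → ℝ} {D : ℝ} (hG : Tendsto G (𝓝[>] 0) (𝓝 D))
    (h : ∀ ρ : ContDiffBump (0 : V), dualDist (c11Ball Λ (mollConst ρ)) m n ≤ G ρ.rOut) :
    dualDist (blBall Λ) m n ≤ D := by
  set M := max (m.real univ) (n.real univ)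
  have error_tendsto : Tendsto (fun ε : ℝ => G ε + 2 * (ε * M)) (𝓝[>] 0) (𝓝 (D + 2 * (0 * M))) :=
    hG.add ((tendsto_id'.2 nhdsWithin_le_nhds).mul_const M |>.const_mul 2)
  rw [zero_mul, mul_zero, add_zero] at error_tendsto
  refine ge_of_tendsto error_tendsto (eventually_mem_nhdsWithin.mono fun ε (hε : 0 < ε) => ?_)
  let ρ : ContDiffBump (0 : V) := ⟨ε / 2, ε, half_pos hε, half_lt_self hε⟩
  have mollified := dualDist_blBall_le (Λ := Λ) (le_max_left _ _ : m.real univ ≤ M)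
    (le_max_right _ _) ρ
  exact mollified.trans (add_le_add_left (h ρ) _)

end DualDistance

section MeanField

variable {V : Type*} [NormedAddCommGroup V] [NormedSpace ℝ V]

/-- A bounded Lipschitz periodic drift and a bounded Lipschitz biperiodic interaction kernel. -/
structure IsKernel (Λ : Set V) (B L : ℝ≥0) (b : V → V) (k : V → V → V) : Prop where
  drift : IsBL Λ B L b
  left : ∀ w, IsBL Λ B L (k · w)
  right : ∀ z, IsBL Λ B L (k z)

variable [MeasurableSpace V]

/-- The mean field generated by the measure `m`. -/
noncomputable def field (b : V → V) (k : V → V → V) (m : Measure V) (z : V) : V :=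
  b z + ∫ w, k z w ∂m

/-- The time derivative of `∫ f dm` along the continuity equation `∂ₜ m + div (field b k m · m) = 0`
in weak form. -/
noncomputable def rate (b : V → V) (k : V → V → V) (m : Measure V) (f : V → ℝ) : ℝ :=
  ∫ z, fderiv ℝ f z (field b k m z) ∂m

variable {Λ : Set V} {B L M A : ℝ≥0} {b : V → V} {k : V → V → V} {m n : Measure V} {f : V → ℝ}

variable [BorelSpace V] [FiniteDimensional ℝ V] [IsFiniteMeasure m] [IsFiniteMeasure n]

theorem IsKernel.isBL_field (hk : IsKernel Λ B L b k) (hM : m.real univ ≤ M) :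
    IsBL Λ (B * (1 + M)) (L * (1 + M)) (field b k m) := by
  have interaction : IsBL Λ (M * B) (M * L) (fun z => ∫ w, k z w ∂m) :=
    .integral (a := fun _ => 1) (fun z => (hk.right z).integrable m) (integrable_const 1)
      (by simpa using hM) (fun z w => by simpa using (hk.left w).norm_le z)
      (fun z z' w => by simpa using (hk.left w).norm_sub_le z z') fun w => (hk.left w).periodic
  exact (hk.drift.add interaction).mono (by ring_nf; rfl) (by ring_nf; rfl)

theorem IsKernel.norm_field_sub_le (hk : IsKernel Λ B L b k) (z : V) :
    ‖field b k m z - field b k n z‖ ≤ (B + L) * dualDist (blBall Λ) m n := by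
  obtain ⟨ℓ, ℓ_norm, ℓ_apply⟩ := exists_dual_vector'' ℝ (field b k m z - field b k n z)
  have test : IsBL Λ B L fun w => ℓ (k z w) :=
    ((hk.right z).clm_comp ℓ).mono (mul_le_of_le_one_left' ℓ_norm) (mul_le_of_le_one_left' ℓ_norm)
  have dual : ‖field b k m z - field b k n z‖ = ∫ w, ℓ (k z w) ∂m - ∫ w, ℓ (k z w) ∂n := by
    rw [ℓ.integral_comp_comm ((hk.right z).integrable m),
      ℓ.integral_comp_comm ((hk.right z).integrable n), ← map_sub]
    simpa [field] using ℓ_apply.symm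
  rw [dual]
  exact (le_abs_self _).trans test.abs_integral_sub_le

theorem IsKernel.abs_rate_le (hk : IsKernel Λ B L b k) (hM : m.real univ ≤ M)
    (hf : f ∈ c11Ball Λ A) : |rate b k m f| ≤ B * (1 + M) * M := by
  have bound := (IsC11.isBL_fderiv_apply hf (hk.isBL_field hM)).norm_le
  rw [one_mul] at bound
  refine (norm_integral_le_of_norm_le_const (Eventually.of_forall bound)).trans ?_
  push_cast
  gcongr

theorem IsKernel.abs_rate_sub_rate_le (hk : IsKernel Λ B L b k) (hm : m.real univ ≤ M)
    (hn : n.real univ ≤ M) (hf : f ∈ c11Ball Λ A) :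
    |rate b k m f - rate b k n f| ≤
      ((B + L) * M + (B + L + A * B) * (1 + M)) * dualDist (blBall Λ) m n := by
  have hD : 0 ≤ dualDist (blBall Λ) m n := dualDist_nonneg
  have gm := IsC11.isBL_fderiv_apply hf (hk.isBL_field hm)
  have gn := IsC11.isBL_fderiv_apply hf (hk.isBL_field hn)
  have change_field : |rate b k m f - ∫ z, fderiv ℝ f z (field b k n z) ∂m|
      ≤ (B + L) * dualDist (blBall Λ) m n * M := by
    refine (abs_integral_sub_integral_le (gm.integrable m) (gn.integrable m) fun z => ?_).trans
      (mul_le_mul_of_nonneg_left hm (by positivity))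
    rw [← map_sub, ← Real.norm_eq_abs]
    simpa using (fderiv ℝ f z).le_of_opNorm_le_of_le (IsC11.isBL_fderiv hf |>.norm_le z)
      (hk.norm_field_sub_le (m := m) (n := n) z)
  have change_measure := gn.abs_integral_sub_le (m := m) (n := n)
  push_cast at change_measure
  calc |rate b k m f - rate b k n f|
      ≤ _ := abs_sub_le _ (∫ z, fderiv ℝ f z (field b k n z) ∂m) _
    _ ≤ _ := add_le_add change_field change_measure
    _ = _ := by ring

end MeanField

section WeakSolution

variable {V : Type*} [NormedAddCommGroup V] [MeasurableSpace V]

theorem tendsto_integral_of_tight [BorelSpace V] [SecondCountableTopology V] {τ : Type*}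
    {ℱ : Filter τ} {m : τ → Measure V} [∀ t, IsFiniteMeasure (m t)] {M : ℝ}
    (hM : ∀ t, (m t).real univ ≤ M) {K : Set V} (hK : IsCompact K) (hmK : ∀ t, m t Kᶜ = 0)
    {Λ : Set V} {B L : ℝ≥0} {u : τ → V → ℝ} {u₀ : V → ℝ} (hu : ∀ t, IsBL Λ B L (u t))
    (hu₀ : IsBL Λ B L u₀) (hlim : ∀ z, Tendsto (u · z) ℱ (𝓝 (u₀ z))) {I : ℝ}
    (hI : Tendsto (fun t => ∫ z, u₀ z ∂(m t)) ℱ (𝓝 I)) :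
    Tendsto (fun t => ∫ z, u t z ∂(m t)) ℱ (𝓝 I) := by
  have equicontinuous : EquicontinuousOn u K :=
    (LipschitzWith.uniformEquicontinuous u L fun t => (hu t).lipschitz).equicontinuous
      |>.equicontinuousOn K
  have uniform : TendstoUniformlyOn u u₀ ℱ K :=
    UniformOnFun.tendsto_iff_tendstoUniformlyOn.1
      ((EquicontinuousOn.tendsto_uniformOnFun_iff_pi' (𝔖 := {K}) (by simpa using hK)
        (by simpa using equicontinuous) ℱ u₀).2 (tendsto_pi_nhds.2 fun z => hlim z)) K rfl
  refine hI.congr_dist (Metric.tendsto_nhds.2 fun ε hε => ?_)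
  filter_upwards [Metric.tendstoUniformlyOn_iff.1 uniform (ε / (|M| + 1)) (by positivity)] with t ht
  have on_K : ∀ᵐ z ∂(m t), ‖u₀ z - u t z‖ ≤ ε / (|M| + 1) := by
    filter_upwards [(hmK t : ∀ᵐ z ∂(m t), z ∈ K)] with z hz
    exact (ht z hz).le
  rw [dist_zero_right, Real.norm_of_nonneg dist_nonneg, dist_eq_norm,
    ← integral_sub (hu₀.integrable _) ((hu t).integrable _)]
  calc ‖∫ z, (u₀ z - u t z) ∂(m t)‖ ≤ ε / (|M| + 1) * (m t).real univ :=
        norm_integral_le_of_norm_le_const on_K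
    _ ≤ ε / (|M| + 1) * |M| := by
        gcongr
        exact (hM t).trans (le_abs_self M)
    _ < ε := by
        rw [div_mul_eq_mul_div, div_lt_iff₀ (by positivity)]
        linarith

variable [NormedSpace ℝ V]

/-- Measure-valued weak solutions of `∂ₜ m + div (field b k m · m) = 0` on `[0, T)` whose masses are
at most `M` and which stay in one compact set. -/
structure IsWeakSol (Λ : Set V) (b : V → V) (k : V → V → V) (M : ℝ≥0) (T : ℝ)
    (m : ℝ → Measure V) : Prop where
  measure_univ_le : ∀ t ∈ Icc 0 T, m t univ ≤ M
  tight : ∃ K, IsCompact K ∧ ∀ t ∈ Icc 0 T, m t Kᶜ = 0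
  continuousOn : ∀ {B L : ℝ≥0} {f : V → ℝ}, IsBL Λ B L f →
    ContinuousOn (fun t => ∫ z, f z ∂(m t)) (Icc 0 T)
  equation : ∀ {B L A : ℝ≥0} {f : V → ℝ}, IsC11 Λ B L A f → ∀ t ∈ Ico 0 T,
    ∫ z, f z ∂(m t) - ∫ z, f z ∂(m 0) = ∫ s in (0 : ℝ)..t, rate b k (m s) f

variable {Λ : Set V} {B L M A : ℝ≥0} {b : V → V} {k : V → V → V} {T s t : ℝ} {m n : ℝ → Measure V}
  {f : V → ℝ}

theorem IsWeakSol.isFiniteMeasure (hm : IsWeakSol Λ b k M T m) (ht : t ∈ Icc 0 T) :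
    IsFiniteMeasure (m t) :=
  ⟨(hm.measure_univ_le t ht).trans_lt ENNReal.coe_lt_top⟩

theorem IsWeakSol.real_univ_le (hm : IsWeakSol Λ b k M T m) (ht : t ∈ Icc 0 T) :
    (m t).real univ ≤ M :=
  ENNReal.toReal_le_of_le_ofReal M.2 (by simpa using hm.measure_univ_le t ht)

variable [BorelSpace V] [FiniteDimensional ℝ V]

theorem IsWeakSol.continuousOn_rate (hm : IsWeakSol Λ b k M T m) (hk : IsKernel Λ B L b k)
    (hf : f ∈ c11Ball Λ A) : ContinuousOn (fun t => rate b k (m t) f) (Icc 0 T) := by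
  obtain ⟨K, hK, hmK⟩ := hm.tight
  have (t : Icc 0 T) : IsFiniteMeasure (m t) := hm.isFiniteMeasure t.2
  have integrand_isBL (t : Icc 0 T) :=
    IsC11.isBL_fderiv_apply hf (hk.isBL_field (hm.real_univ_le t.2))
  have integrand_continuous (z : V) :
      Continuous fun t : Icc 0 T => fderiv ℝ f z (field b k (m t) z) := by
    have test := hm.continuousOn ((hk.right z).clm_comp (fderiv ℝ f z))
    refine (continuous_const.add (continuousOn_iff_continuous_domRestrict.1 test)).congr
      (f := fun t => fderiv ℝ f z (b z) + _) fun t => ?_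
    rw [field, map_add, Set.domRestrict_apply,
      (fderiv ℝ f z).integral_comp_comm ((hk.right z).integrable _)]
  refine continuousOn_iff_continuous_domRestrict.2 (continuous_iff_continuousAt.2 fun t => ?_)
  exact tendsto_integral_of_tight (fun t : Icc 0 T => hm.real_univ_le t.2) hK
    (fun t => hmK t t.2) integrand_isBL (integrand_isBL t)
    (fun z => (integrand_continuous z).continuousAt)
    (continuousOn_iff_continuous_domRestrict.1 (hm.continuousOn (integrand_isBL t))).continuousAt

theorem IsWeakSol.intervalIntegrable_rate (hm : IsWeakSol Λ b k M T m) (hk : IsKernel Λ B L b k)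
    (hf : f ∈ c11Ball Λ A) (hs : 0 ≤ s) (hst : s ≤ t) (ht : t < T) :
    IntervalIntegrable (fun r => rate b k (m r) f) volume s t :=
  ((hm.continuousOn_rate hk hf).mono (Icc_subset_Icc hs ht.le)).intervalIntegrable_of_Icc hst

theorem IsWeakSol.integral_sub_integral (hm : IsWeakSol Λ b k M T m) (hk : IsKernel Λ B L b k)
    (hf : f ∈ c11Ball Λ A) (hs : 0 ≤ s) (hst : s ≤ t) (ht : t < T) :
    ∫ z, f z ∂(m t) - ∫ z, f z ∂(m s) = ∫ r in s..t, rate b k (m r) f := by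
  have split := intervalIntegral.integral_add_adjacent_intervals
    (hm.intervalIntegrable_rate hk hf le_rfl hs (hst.trans_lt ht))
    (hm.intervalIntegrable_rate hk hf hs hst ht)
  linarith [hm.equation hf s ⟨hs, hst.trans_lt ht⟩, hm.equation hf t ⟨hs.trans hst, ht⟩]

theorem IsWeakSol.dualDist_c11Ball_le (hm : IsWeakSol Λ b k M T m) (hk : IsKernel Λ B L b k)
    (hs : 0 ≤ s) (hst : s ≤ t) (ht : t < T) :
    dualDist (c11Ball Λ A) (m t) (m s) ≤ B * (1 + M) * M * (t - s) := by
  refine dualDist_le (mul_nonneg (by positivity) (sub_nonneg.2 hst)) fun f hf => ?_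
  rw [hm.integral_sub_integral hk hf hs hst ht, ← abs_of_nonneg (sub_nonneg.2 hst),
    ← Real.norm_eq_abs (∫ r in s..t, _)]
  refine intervalIntegral.norm_integral_le_of_norm_le_const fun r hr => ?_
  rw [uIoc_of_le hst] at hr
  have hr : r ∈ Icc 0 T := ⟨hs.trans hr.1.le, hr.2.trans ht.le⟩
  have := hm.isFiniteMeasure hr
  exact hk.abs_rate_le (hm.real_univ_le hr) hf

theorem IsWeakSol.dualDist_blBall_le (hm : IsWeakSol Λ b k M T m) (hk : IsKernel Λ B L b k)
    (hs : 0 ≤ s) (hst : s ≤ t) (ht : t < T) :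
    dualDist (blBall Λ) (m t) (m s) ≤ B * (1 + M) * M * (t - s) := by
  have := hm.isFiniteMeasure ⟨hs, hst.trans ht.le⟩
  have := hm.isFiniteMeasure ⟨hs.trans hst, ht.le⟩
  exact dualDist_blBall_le_of_tendsto tendsto_const_nhds fun _ =>
    hm.dualDist_c11Ball_le hk hs hst ht

theorem IsWeakSol.abs_integral_sub_integral_sub_rate_le (hm : IsWeakSol Λ b k M T m)
    (hk : IsKernel Λ B L b k) (hf : f ∈ c11Ball Λ A) (hs : 0 ≤ s) (hst : s ≤ t) (ht : t < T) :
    |∫ z, f z ∂(m t) - ∫ z, f z ∂(m s) - (t - s) * rate b k (m s) f| ≤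
      ((B + L) * M + (B + L + A * B) * (1 + M)) * (B * (1 + M) * M) * (t - s) ^ 2 := by
  have remainder : ∫ z, f z ∂(m t) - ∫ z, f z ∂(m s) - (t - s) * rate b k (m s) f
      = ∫ r in s..t, (rate b k (m r) f - rate b k (m s) f) := by
    rw [hm.integral_sub_integral hk hf hs hst ht, intervalIntegral.integral_sub
      (hm.intervalIntegrable_rate hk hf hs hst ht) intervalIntegrable_const,
      intervalIntegral.integral_const, smul_eq_mul]
  rw [remainder, ← sq_abs, sq |t - s|, ← mul_assoc, ← Real.norm_eq_abs (∫ r in s..t, _)]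
  refine intervalIntegral.norm_integral_le_of_norm_le_const fun r hr => ?_
  rw [uIoc_of_le hst] at hr
  have hsT : s ∈ Icc 0 T := ⟨hs, hst.trans ht.le⟩
  have hrT : r ∈ Icc 0 T := ⟨hs.trans hr.1.le, hr.2.trans ht.le⟩
  have := hm.isFiniteMeasure hsT
  have := hm.isFiniteMeasure hrT
  refine (hk.abs_rate_sub_rate_le (hm.real_univ_le hrT) (hm.real_univ_le hsT) hf).trans ?_
  rw [mul_assoc]
  gcongr
  refine (hm.dualDist_blBall_le hk hs hr.1.le (hr.2.trans_lt ht)).trans ?_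
  rw [abs_of_nonneg (sub_nonneg.2 hst)]
  gcongr
  exact hr.2

theorem IsKernel.abs_integral_euler_sub_le {p : Measure V} [IsFiniteMeasure p] {δ b₀ l : ℝ≥0}
    {η : ℝ} {c : V → V} (hk : IsKernel Λ B L b k) (hp : p.real univ ≤ M) (hf : f ∈ c11Ball Λ A)
    (hc : IsBL Λ b₀ l c) (near : ∀ z, ‖c z - field b k p z‖ ≤ η) :
    |∫ z, f (z + (δ : ℝ) • c z) ∂p - (∫ z, f z ∂p + δ * rate b k p f)| ≤
      (A * b₀ ^ 2 * δ ^ 2 + η * δ) * M := by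
  have hη : 0 ≤ η := (norm_nonneg _).trans (near 0)
  have f_int := (c11Ball_subset_blBall _ _ hf).integrable p
  have rate_int := (IsC11.isBL_fderiv_apply hf (hk.isBL_field hp)).integrable p
  have pointwise (z : V) : |f (z + (δ : ℝ) • c z) - (f z + δ * fderiv ℝ f z (field b k p z))|
      ≤ A * b₀ ^ 2 * δ ^ 2 + η * δ := by
    have taylor : |f (z + (δ : ℝ) • c z) - f z - fderiv ℝ f z ((δ : ℝ) • c z)|
        ≤ A * b₀ ^ 2 * δ ^ 2 := by
      refine (IsC11.norm_add_sub_sub_fderiv_le hf z ((δ : ℝ) • c z)).trans ?_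
      rw [norm_smul, NNReal.norm_eq, mul_pow, mul_assoc, mul_comm ((b₀ : ℝ) ^ 2)]
      gcongr
      exact hc.norm_le z
    have linear : |δ * fderiv ℝ f z (c z - field b k p z)| ≤ δ * (1 * η) := by
      rw [abs_mul, NNReal.abs_eq]
      gcongr
      exact (fderiv ℝ f z).le_of_opNorm_le_of_le (IsC11.isBL_fderiv hf |>.norm_le z) (near z)
    rw [map_sub] at linear
    rw [map_smul, smul_eq_mul] at taylor
    grind
  rw [rate, ← integral_const_mul, ← integral_add f_int (rate_int.const_mul _)]
  refine (abs_integral_sub_integral_le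
    (((c11Ball_subset_blBall _ _ hf).comp_euler hc).integrable p)
    (f_int.add (rate_int.const_mul _)) pointwise).trans ?_
  gcongr

theorem IsKernel.exists_abs_integral_sub_euler_le (hk : IsKernel Λ B L b k) (M A : ℝ≥0) :
    ∃ Q : ℝ≥0, ∀ {T s : ℝ} {δ l : ℝ≥0} {η : ℝ} {m : ℝ → Measure V} {f : V → ℝ} {c : V → V},
      IsWeakSol Λ b k M T m → f ∈ c11Ball Λ A → 0 ≤ s → s + δ < T → IsBL Λ (B * (1 + M)) l c →
      (∀ z, ‖c z - field b k (m s) z‖ ≤ η) →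
      |∫ z, f z ∂(m (s + δ)) - ∫ z, f (z + (δ : ℝ) • c z) ∂(m s)| ≤ Q * δ ^ 2 + M * η * δ := by
  refine ⟨((B + L) * M + (B + L + A * B) * (1 + M)) * (B * (1 + M) * M)
    + A * (B * (1 + M)) ^ 2 * M, ?_⟩
  intro T s δ l η m f c hm hf hs hsT hc near
  have hsT' : s ∈ Icc 0 T := ⟨hs, (le_add_of_nonneg_right δ.coe_nonneg).trans hsT.le⟩
  have := hm.isFiniteMeasure hsT'
  have solution := hm.abs_integral_sub_integral_sub_rate_le hk hf hs
    (le_add_of_nonneg_right δ.coe_nonneg) hsT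
  rw [add_sub_cancel_left] at solution
  have euler := hk.abs_integral_euler_sub_le (hm.real_univ_le hsT') hf hc near (δ := δ)
  push_cast at euler ⊢
  grind

end WeakSolution

section Stability

variable {V : Type*} [NormedAddCommGroup V] [NormedSpace ℝ V]
variable {Λ : Set V} {B L M : ℝ≥0} {b : V → V} {k : V → V → V} {T : ℝ}

theorem inv_smul_comp_euler_mem_c11Ball {A b l δ : ℝ≥0} {f : V → ℝ} {c : V → V}
    (hf : f ∈ c11Ball Λ A) (hc : IsC11 Λ b l (l * A) c) (hδ : δ ≤ 1) :
    (fun z => (((1 + δ * (3 * l + l ^ 2))⁻¹ : ℝ≥0) : ℝ) • f (z + (δ : ℝ) • c z)) ∈ c11Ball Λ A := by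
  have sq_le : δ ^ 2 ≤ δ := by simpa [sq] using mul_le_mul_right hδ δ
  have growth_sq : (1 + δ * l) * (1 + δ * l) + δ * l ≤ 1 + δ * (3 * l + l ^ 2) := by
    linarith [mul_le_mul_left sq_le (l ^ 2)]
  have growth : 1 + δ * l ≤ 1 + δ * (3 * l + l ^ 2) := by
    gcongr
    linarith [(by positivity : 0 ≤ l ^ 2 + 2 * l)]
  refine ((IsC11.comp_euler hf hc).const_smul _).mono ?_ ?_ ?_ <;>
    rw [inv_mul_le_iff₀ (by positivity)]
  · simp
  · simpa using growth
  · calc 1 * (δ * (l * A)) + A * (1 + δ * l) * (1 + δ * l)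
        = ((1 + δ * l) * (1 + δ * l) + δ * l) * A := by ring
      _ ≤ _ := by gcongr

/-- The exponential rate at which weak solutions with kernel bounds `B`, `L` and masses at most `M`
can separate in the bounded Lipschitz distance. -/
noncomputable def stabilityRate (B L M : ℝ≥0) : ℝ≥0 :=
  3 * (L * (1 + M)) + (L * (1 + M)) ^ 2 + (B + L) * M

variable [FiniteDimensional ℝ V] [MeasurableSpace V] [BorelSpace V]
variable {m n : ℝ → Measure V}

/-- The growth rate of the distance at mollification scale `ρ.rOut` does not depend on the
Lipschitz constant `mollConst ρ` of the derivatives of the test functions. -/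
theorem IsKernel.exists_dualDist_add_le (hk : IsKernel Λ B L b k) (M : ℝ≥0)
    (ρ : ContDiffBump (0 : V)) :
    ∃ Q : ℝ≥0, ∀ {T s : ℝ} {δ : ℝ≥0} {m n : ℝ → Measure V},
      IsWeakSol Λ b k M T m → IsWeakSol Λ b k M T n → 0 ≤ s → δ ≤ 1 → s + δ < T →
      dualDist (c11Ball Λ (mollConst ρ)) (m (s + δ)) (n (s + δ)) ≤
        dualDist (c11Ball Λ (mollConst ρ)) (m s) (n s)
        + δ * (stabilityRate B L M * dualDist (c11Ball Λ (mollConst ρ)) (m s) (n s)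
          + 2 * M * (L * (1 + M) + M * (B + L)) * ρ.rOut) + Q * δ ^ 2 := by
  obtain ⟨Q, euler⟩ := hk.exists_abs_integral_sub_euler_le M (mollConst ρ)
  refine ⟨2 * Q, fun {T s δ m n} hm hn hs hδ hsT => ?_⟩
  set d := dualDist (c11Ball Λ (mollConst ρ)) (m s) (n s)
  have hd : 0 ≤ d := dualDist_nonneg
  have hρ := ρ.rOut_pos
  have hsT' : s ∈ Icc 0 T := ⟨hs, (le_add_of_nonneg_right δ.coe_nonneg).trans hsT.le⟩
  have := hm.isFiniteMeasure hsT'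
  have := hn.isFiniteMeasure hsT'
  obtain ⟨c, hc, c_near⟩ := (hk.isBL_field (hm.real_univ_le hsT')).exists_isC11_near ρ
  have c_near' (z : V) : ‖c z - field b k (n s) z‖
      ≤ ↑(L * (1 + M)) * ρ.rOut + (B + L) * (d + 2 * (ρ.rOut * M)) := by
    refine (norm_sub_le_norm_sub_add_norm_sub _ (field b k (m s) z) _).trans
      (add_le_add (c_near z) ((hk.norm_field_sub_le z).trans ?_))
    gcongr
    exact dualDist_blBall_le (hm.real_univ_le hsT') (hn.real_univ_le hsT') ρ
  refine dualDist_le (by positivity) fun f hf => ?_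
  have euler_m := euler hm hf hs hsT hc.toIsBL c_near
  have euler_n := euler hn hf hs hsT hc.toIsBL c_near'
  have transported : |∫ z, f (z + (δ : ℝ) • c z) ∂(m s) - ∫ z, f (z + (δ : ℝ) • c z) ∂(n s)|
      ≤ (1 + δ * (3 * (L * (1 + M)) + (L * (1 + M)) ^ 2) : ℝ≥0) * d :=
    abs_integral_sub_le_mul_dualDist (c11Ball_subset_blBall _ _) (by positivity)
      (inv_smul_comp_euler_mem_c11Ball hf hc hδ)
  rw [stabilityRate]
  push_cast at euler_m euler_n transported ⊢
  grind

theorem le_gronwallBound_of_le_step {D : ℝ → ℝ} {C ε Q D₀ : ℝ} (hD : ContinuousOn D (Ico 0 T))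
    (hD₀ : D 0 ≤ D₀)
    (step : ∀ s, ∀ δ : ℝ≥0, 0 ≤ s → δ ≤ 1 → s + δ < T →
      D (s + δ) ≤ D s + δ * (C * D s + ε) + Q * δ ^ 2) :
    ∀ t ∈ Ico 0 T, D t ≤ gronwallBound D₀ C ε t := by
  intro t ht
  suffices ∀ s ∈ Icc 0 t, D s ≤ gronwallBound D₀ C ε (s - 0) by
    simpa using this t ⟨ht.1, le_rfl⟩
  refine le_gronwallBound_of_liminf_deriv_right_le (f' := fun s => C * D s + ε)
    (hD.mono fun s hs => ⟨hs.1, hs.2.trans_lt ht.2⟩) (fun s hs r hr => ?_) hD₀ fun _ _ => le_rfl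
  have rate_tendsto : Tendsto (fun z => C * D s + ε + Q * (z - s)) (𝓝[>] s)
      (𝓝 (C * D s + ε)) :=
    ((by fun_prop : Continuous fun z => C * D s + ε + Q * (z - s)).tendsto' s _ (by simp)).mono_left
      nhdsWithin_le_nhds
  have hs_lt : s < min T (s + 1) := lt_min (hs.2.trans ht.2) (lt_add_one s)
  refine Eventually.frequently ?_
  filter_upwards [rate_tendsto.eventually_lt_const hr, Ioo_mem_nhdsGT hs_lt] with z rate_lt hz
  have hz_pos : 0 < z - s := sub_pos.2 hz.1
  obtain ⟨δ, rfl⟩ : ∃ δ : ℝ≥0, z = s + δ := ⟨⟨z - s, hz_pos.le⟩, (add_sub_cancel s z).symm⟩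
  have hδ := lt_min_iff.1 hz.2
  rw [add_sub_cancel_left] at hz_pos rate_lt ⊢
  refine lt_of_le_of_lt ?_ rate_lt
  rw [inv_mul_le_iff₀ hz_pos]
  linarith [step s δ hs.1 (by simpa using hδ.2.le) hδ.1]

theorem IsWeakSol.continuousOn_dualDist (hm : IsWeakSol Λ b k M T m) (hn : IsWeakSol Λ b k M T n)
    (hk : IsKernel Λ B L b k) (A : ℝ≥0) :
    ContinuousOn (fun t => dualDist (c11Ball Λ A) (m t) (n t)) (Ico 0 T) := by
  have increment {p : ℝ → Measure V} (hp : IsWeakSol Λ b k M T p) {s t : ℝ} (hs : s ∈ Ico 0 T)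
      (ht : t ∈ Ico 0 T) : dualDist (c11Ball Λ A) (p s) (p t) ≤ B * (1 + M) * M * |s - t| := by
    rcases le_total t s with h | h
    · rw [abs_of_nonneg (sub_nonneg.2 h)]
      exact hp.dualDist_c11Ball_le hk ht.1 h hs.2
    · rw [dualDist_comm, abs_sub_comm, abs_of_nonneg (sub_nonneg.2 h)]
      exact hp.dualDist_c11Ball_le hk hs.1 h ht.2
  have finite {p : ℝ → Measure V} (hp : IsWeakSol Λ b k M T p) (t : Ico 0 T) :
      IsFiniteMeasure (p t) := hp.isFiniteMeasure (Ico_subset_Icc_self t.2)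
  refine LipschitzOnWith.continuousOn (K := 2 * (B * (1 + M) * M))
    (LipschitzOnWith.of_le_add_mul _ fun s hs t ht => ?_)
  have := finite hm ⟨s, hs⟩
  have := finite hm ⟨t, ht⟩
  have := finite hn ⟨s, hs⟩
  have := finite hn ⟨t, ht⟩
  have h𝓕 := c11Ball_subset_blBall Λ A
  have increment_n := increment hn ht hs
  rw [abs_sub_comm] at increment_n
  rw [Real.dist_eq]
  push_cast
  linarith [dualDist_triangle (m := m s) (n := n s) h𝓕 (m t), increment hm hs ht,
    dualDist_triangle (m := m t) (n := n s) h𝓕 (n t), increment_n]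

theorem IsWeakSol.dualDist_le_exp (hm : IsWeakSol Λ b k M T m) (hn : IsWeakSol Λ b k M T n)
    (hk : IsKernel Λ B L b k) {t : ℝ} (ht : t ∈ Ico 0 T) :
    dualDist (blBall Λ) (m t) (n t) ≤
      dualDist (blBall Λ) (m 0) (n 0) * Real.exp (stabilityRate B L M * t) := by
  have h0 : (0 : ℝ) ∈ Icc 0 T := ⟨le_rfl, ht.1.trans ht.2.le⟩
  have := hm.isFiniteMeasure h0
  have := hn.isFiniteMeasure h0
  have := hm.isFiniteMeasure (Ico_subset_Icc_self ht)
  have := hn.isFiniteMeasure (Ico_subset_Icc_self ht)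
  set C := 2 * M * (L * (1 + M) + M * (B + L))
  have bound_tendsto : Tendsto
      (fun ε => gronwallBound (dualDist (blBall Λ) (m 0) (n 0)) (stabilityRate B L M) (C * ε) t)
      (𝓝[>] 0) (𝓝 (dualDist (blBall Λ) (m 0) (n 0) * Real.exp (stabilityRate B L M * t))) := by
    refine (((gronwallBound_continuous_ε _ _ t).comp (continuous_const_mul (C : ℝ))).tendsto' 0 _
      ?_).mono_left nhdsWithin_le_nhds
    simp [gronwallBound_ε0]
  refine dualDist_blBall_le_of_tendsto bound_tendsto fun ρ => ?_
  obtain ⟨Q, step⟩ := hk.exists_dualDist_add_le M ρ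
  exact le_gronwallBound_of_le_step (hm.continuousOn_dualDist hn hk _)
    (dualDist_mono (c11Ball_subset_blBall _ _) subset_rfl)
    (fun s δ hs hδ hsT => step hm hn hs hδ hsT) t ht

theorem IsWeakSol.stability (hm : IsWeakSol Λ b k M T m) (hn : IsWeakSol Λ b k M T n)
    (hk : IsKernel Λ B L b k) (hT : 0 < T) {t : ℝ} (ht : t ∈ Icc 0 T) :
    dualDist (blBall Λ) (m t) (n t) ≤
      Real.exp (stabilityRate B L M * T) * dualDist (blBall Λ) (m 0) (n 0) := by
  have hd : 0 ≤ dualDist (blBall Λ) (m 0) (n 0) := dualDist_nonneg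
  refine dualDist_le (by positivity) fun f hf => ?_
  rw [← closure_Ico hT.ne] at ht
  refine le_on_closure (s := Ico 0 T) (f := fun t => |∫ z, f z ∂(m t) - ∫ z, f z ∂(n t)|)
    (g := fun _ => _) (fun s hs => ?_) ?_ continuousOn_const ht
  · have := hm.isFiniteMeasure (Ico_subset_Icc_self hs)
    have := hn.isFiniteMeasure (Ico_subset_Icc_self hs)
    refine (le_dualDist subset_rfl hf).trans ((hm.dualDist_le_exp hn hk hs).trans ?_)
    rw [mul_comm]
    gcongr
    exact hs.2.le
  · rw [closure_Ico hT.ne]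
    exact ((hm.continuousOn hf).sub (hn.continuousOn hf)).abs

end Stability

section BoundedLipschitzClass

variable {U V W : Type*} [NormedAddCommGroup U] [NormedSpace ℝ U] [NormedAddCommGroup V]
variable [NormedAddCommGroup W] {Λ : Set V} {f g : V → W}

/-- The bounded Lipschitz `Λ`-periodic functions, with unspecified bounds. -/
def BddLip (Λ : Set V) (f : V → W) : Prop := ∃ B L : ℝ≥0, IsBL Λ B L f

theorem bddLip_const (c : W) : BddLip Λ fun _ => c :=
  ⟨‖c‖₊, 0, fun _ => le_rfl, .const c, fun _ _ _ => rfl⟩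

theorem BddLip.prodMk {W' : Type*} [NormedAddCommGroup W'] {h : V → W'} (hf : BddLip Λ f)
    (hh : BddLip Λ h) : BddLip Λ (fun x => (f x, h x)) := by
  obtain ⟨B, L, hf⟩ := hf
  obtain ⟨B', L', hh⟩ := hh
  exact ⟨max B B', max L L', fun x => max_le_max (hf.norm_le x) (hh.norm_le x),
    hf.lipschitz.prodMk hh.lipschitz,
    fun p hp x => by rw [hf.periodic p hp x, hh.periodic p hp x]⟩

theorem BddLip.comp_clm [NormedSpace ℝ V] {Λ' : Set U} (hf : BddLip Λ f) (ℓ : U →L[ℝ] V)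
    (hℓ : MapsTo ℓ Λ' Λ) : BddLip Λ' (fun x => f (ℓ x)) := by
  obtain ⟨B, L, hf⟩ := hf
  exact ⟨B, L * ‖ℓ‖₊, fun x => hf.norm_le _, hf.lipschitz.comp ℓ.lipschitz,
    fun p hp x => by rw [map_add, hf.periodic _ (hℓ hp)]⟩

variable [NormedSpace ℝ W]

theorem BddLip.clm_comp {W' : Type*} [NormedAddCommGroup W'] [NormedSpace ℝ W']
    (hf : BddLip Λ f) (ℓ : W →L[ℝ] W') : BddLip Λ (fun x => ℓ (f x)) := by
  obtain ⟨B, L, hf⟩ := hf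
  exact ⟨_, _, hf.clm_comp ℓ⟩

theorem BddLip.sub (hf : BddLip Λ f) (hg : BddLip Λ g) : BddLip Λ (fun x => f x - g x) :=
  (hf.prodMk hg).clm_comp (ContinuousLinearMap.fst ℝ W W - ContinuousLinearMap.snd ℝ W W)

theorem BddLip.smul {a : V → ℝ} (ha : BddLip Λ a) (hf : BddLip Λ f) :
    BddLip Λ (fun x => a x • f x) := by
  obtain ⟨B, L, ha⟩ := ha
  obtain ⟨B', L', hf⟩ := hf
  exact ⟨_, _, ha.bilin (.lsmul ℝ ℝ) ContinuousLinearMap.opNorm_lsmul_le hf⟩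

theorem BddLip.exists_isKernel {b : V → V} {k : V → V → V} (h0 : (0 : V) ∈ Λ) (hb : BddLip Λ b)
    (hk : BddLip (Λ ×ˢ Λ) fun q : V × V => k q.1 q.2) : ∃ B L, IsKernel Λ B L b k := by
  obtain ⟨B, L, hb⟩ := hb
  obtain ⟨B', L', hk⟩ := hk
  refine ⟨max B B', max L L', hb.mono (le_max_left _ _) (le_max_left _ _), fun w => ?_,
    fun z => ?_⟩
  · refine IsBL.mono (B := B') (L := L') ⟨fun z => hk.norm_le (z, w), ?_, fun p hp z => ?_⟩
      (le_max_right _ _) (le_max_right _ _)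
    · simpa [Function.comp_def] using hk.lipschitz.comp (LipschitzWith.prodMk_right w)
    · simpa using hk.periodic (p, 0) ⟨hp, h0⟩ (z, w)
  · refine IsBL.mono (B := B') (L := L') ⟨fun w => hk.norm_le (z, w), ?_, fun p hp w => ?_⟩
      (le_max_right _ _) (le_max_right _ _)
    · simpa [Function.comp_def] using hk.lipschitz.comp (LipschitzWith.prodMk_left z)
    · simpa using hk.periodic (0, p) ⟨h0, hp⟩ (z, w)

end BoundedLipschitzClass

section Cutoff

variable {V W : Type*} [NormedAddCommGroup V] [NormedSpace ℝ V] [FiniteDimensional ℝ V]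
variable [NormedAddCommGroup W] [NormedSpace ℝ W] {K U : Set V}

theorem exists_contDiff_eventuallyEq_one (hK : IsCompact K) (hU : IsOpen U) (hKU : K ⊆ U) :
    ∃ χ : V → ℝ, ContDiff ℝ 1 χ ∧ HasCompactSupport χ ∧ tsupport χ ⊆ U ∧
      ∀ x ∈ K, χ =ᶠ[𝓝 x] 1 := by
  obtain ⟨K', hK', hKK', hK'U⟩ := exists_compact_between hK hU hKU
  obtain ⟨χ, one, zero, -⟩ := exists_contMDiffMap_one_nhds_of_subset_interior (n := 1)
    𝓘(ℝ, V) hK.isClosed hKK'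
  have support_subset : Function.support χ ⊆ K' := fun x hx => by_contra fun h => hx (zero x h)
  exact ⟨χ, χ.contMDiff.contDiff, .of_support_subset_isCompact hK' support_subset,
    (closure_minimal support_subset hK'.isClosed).trans hK'U,
    fun x hx => one.filter_mono (nhds_le_nhdsSet hx)⟩

theorem exists_bddLip_eqOn {f : V → W} (hK : IsCompact K) (hU : IsOpen U) (hKU : K ⊆ U)
    (hf : ContDiffOn ℝ 1 f U) : ∃ ψ : V → W, BddLip {0} ψ ∧ EqOn ψ f K := by
  obtain ⟨χ, hχ, compact, subset, one⟩ := exists_contDiff_eventuallyEq_one hK hU hKU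
  have hχf : ContDiff ℝ 1 fun x => χ x • f x := contDiff_iff_contDiffAt.2 fun x => by
    by_cases hx : x ∈ tsupport χ
    · exact hχ.contDiffAt.smul (hf.contDiffAt (hU.mem_nhds (subset hx)))
    · refine contDiffAt_const (c := 0) |>.congr_of_eventuallyEq ?_
      filter_upwards [notMem_tsupport_iff_eventuallyEq.1 hx] with y hy
      simp [hy]
  have hsupp : HasCompactSupport fun x => χ x • f x := compact.smul_right
  obtain ⟨B, hB⟩ := hsupp.exists_bound_of_continuous hχf.continuous
  obtain ⟨L, hL⟩ := hχf.lipschitzWith_of_hasCompactSupport hsupp one_ne_zero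
  refine ⟨fun x => χ x • f x, ⟨B.toNNReal, L, fun x => (hB x).trans (Real.le_coe_toNNReal B), hL,
    fun p hp x => by simp [mem_singleton_iff.1 hp]⟩, fun x hx => ?_⟩
  simp [(one x hx).self_of_nhds]

end Cutoff

section Cover

variable {d : ℕ}

/-- The universal cover of the phase space, extended to all real temperatures. -/
abbrev Cover (d : ℕ) : Type :=
  EuclideanSpace ℝ (Fin d) × EuclideanSpace ℝ (Fin d) × ℝ

/-- The deck transformations of the torus. -/
def torusPeriods (d : ℕ) : Set (EuclideanSpace ℝ (Fin d)) := {p | toTorus p = 0}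

/-- The deck transformations of the phase space. -/
def periods (d : ℕ) : Set (Cover d) := torusPeriods d ×ˢ {0}

theorem toTorus_add (y y' : EuclideanSpace ℝ (Fin d)) :
    toTorus (y + y') = toTorus y + toTorus y' := rfl

theorem toTorus_sub (y y' : EuclideanSpace ℝ (Fin d)) :
    toTorus (y - y') = toTorus y - toTorus y' := rfl

theorem zero_mem_periods : 0 ∈ periods d := ⟨rfl, rfl⟩

theorem norm_coe_unitAddCircle_le (r : ℝ) : ‖(r : UnitAddCircle)‖ ≤ |r| := by
  rw [UnitAddCircle.norm_eq]
  simpa using round_le r 0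

theorem sum_norm_toTorus_sub_sq_le (y y' : EuclideanSpace ℝ (Fin d)) :
    ∑ i, ‖toTorus y i - toTorus y' i‖ ^ 2 ≤ ‖y - y'‖ ^ 2 := by
  rw [EuclideanSpace.norm_sq_eq]
  gcongr with i
  exact norm_coe_unitAddCircle_le ((y - y') i)

theorem lipschitzWith_toTorus : LipschitzWith 1 (toTorus (d := d)) :=
  LipschitzWith.of_dist_le_mul fun y y' => by
    rw [NNReal.coe_one, one_mul, dist_eq_norm y]
    refine (dist_pi_le_iff (norm_nonneg _)).2 fun i => ?_
    rw [dist_eq_norm]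
    exact (norm_coe_unitAddCircle_le ((y - y') i)).trans (PiLp.norm_apply_le (y - y') i)

theorem BddLip.comp_toTorus {φ : UnitAddTorus (Fin d) → ℝ} {K : ℝ≥0} (hφ : LipschitzWith K φ) :
    BddLip (torusPeriods d) (fun y => φ (toTorus y)) := by
  obtain ⟨B, hB⟩ := isCompact_univ.exists_bound_of_continuousOn hφ.continuous.continuousOn
  refine ⟨B.toNNReal, K * 1, fun y => (hB _ (mem_univ _)).trans (Real.le_coe_toNNReal B),
    hφ.comp lipschitzWith_toTorus, fun p hp y => ?_⟩
  rw [toTorus_add, show toTorus p = 0 from hp, add_zero]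

/-- A measurable section of the covering map, with values in `(0, 1]^d`. -/
noncomputable def torusSec (x : UnitAddTorus (Fin d)) : EuclideanSpace ℝ (Fin d) :=
  WithLp.toLp 2 fun i => (AddCircle.measurableEquivIoc (1 : ℝ) 0 (x i) : ℝ)

@[simp]
theorem toTorus_torusSec (x : UnitAddTorus (Fin d)) : toTorus (torusSec x) = x := by
  ext i
  exact (AddCircle.measurableEquivIoc (1 : ℝ) 0).symm_apply_apply (x i)

theorem measurable_torusSec : Measurable (torusSec (d := d)) := by
  unfold torusSec
  fun_prop

theorem norm_torusSec_le (x : UnitAddTorus (Fin d)) : ‖torusSec x‖ ≤ Real.sqrt d := by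
  rw [EuclideanSpace.norm_eq]
  refine Real.sqrt_le_sqrt ?_
  have coord_le (i : Fin d) : ‖torusSec x i‖ ^ 2 ≤ 1 := by
    have h := (AddCircle.measurableEquivIoc (1 : ℝ) 0 (x i)).2
    rw [Real.norm_eq_abs, sq_abs]
    exact pow_le_one₀ h.1.le (h.2.trans_eq (zero_add 1))
  simpa using Finset.sum_le_card_nsmul Finset.univ _ 1 fun i _ => coord_le i

theorem exists_toTorus_eq (x : UnitAddTorus (Fin d)) :
    ∃ y : EuclideanSpace ℝ (Fin d), toTorus y = x ∧ ‖y‖ ^ 2 = ∑ i, ‖x i‖ ^ 2 := by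
  refine ⟨WithLp.toLp 2 fun i => torusSec x i - round (torusSec x i), ?_, ?_⟩
  · conv_rhs => rw [← toTorus_torusSec x]
    ext i
    simp only [toTorus, AddCircle.coe_sub, sub_eq_self]
    exact AddCircle.coe_eq_zero_iff 1 |>.2 ⟨round (torusSec x i), by simp⟩
  · rw [EuclideanSpace.norm_sq_eq]
    conv_rhs => rw [← toTorus_torusSec x]
    simp only [toTorus, UnitAddCircle.norm_eq, Real.norm_eq_abs]

/-- The measurable section of the covering of the phase space. -/
noncomputable def lift (z : Phase d) : Cover d := (torusSec z.1, z.2.1, (z.2.2 : ℝ))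

theorem measurable_lift : Measurable (lift (d := d)) :=
  (measurable_torusSec.comp measurable_fst).prodMk (by fun_prop)

theorem continuous_snd_lift : Continuous fun z : Phase d => (lift z).2 := by
  unfold lift
  fun_prop

theorem eq_of_toTorus_eq {W : Type*} {f : Cover d → W}
    (hf : ∀ p ∈ periods d, Function.Periodic f p) {y y' : EuclideanSpace ℝ (Fin d)}
    (h : toTorus y = toTorus y') (q : EuclideanSpace ℝ (Fin d) × ℝ) : f (y, q) = f (y', q) := by
  have hp : (y - y', 0) ∈ periods d := ⟨(toTorus_sub y y').trans (sub_eq_zero.2 h), rfl⟩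
  simpa using hf _ hp (y', q)

theorem norm_sub_le_phaseDist {z z' : Phase d} {y : EuclideanSpace ℝ (Fin d)}
    (hy : ‖y‖ ^ 2 = ∑ i, ‖(z.1 - z'.1) i‖ ^ 2) :
    ‖((y, z.2.1 - z'.2.1, (z.2.2 : ℝ) - z'.2.2) : Cover d)‖ ≤ phaseDist z z' := by
  have expand : phaseDist z z' = √(‖y‖ ^ 2 + ‖z.2.1 - z'.2.1‖ ^ 2
      + ‖(z.2.2 : ℝ) - z'.2.2‖ ^ 2) := by
    rw [hy, Real.norm_eq_abs, sq_abs]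
    rfl
  rw [expand]
  refine norm_prod_le_iff.2 ⟨?_, norm_prod_le_iff.2 ⟨?_, ?_⟩⟩ <;>
  · refine Real.le_sqrt_of_sq_le ?_
    simp only
    linarith [sq_nonneg ‖y‖, sq_nonneg ‖z.2.1 - z'.2.1‖, sq_nonneg ‖(z.2.2 : ℝ) - z'.2.2‖]

theorem abs_lift_sub_le {B L : ℝ≥0} {f : Cover d → ℝ} (hf : IsBL (periods d) B L f)
    (z z' : Phase d) : |f (lift z) - f (lift z')| ≤ L * phaseDist z z' := by
  obtain ⟨y, hy, hn⟩ := exists_toTorus_eq (z.1 - z'.1)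
  have shift : f (lift z) = f (torusSec z'.1 + y, z.2.1, (z.2.2 : ℝ)) :=
    eq_of_toTorus_eq hf.periodic (by simp [toTorus_add, hy]) _
  calc |f (lift z) - f (lift z')|
      ≤ L * ‖((y, z.2.1 - z'.2.1, (z.2.2 : ℝ) - z'.2.2) : Cover d)‖ := by
        rw [shift]
        simpa [lift] using hf.norm_sub_le (torusSec z'.1 + y, z.2.1, (z.2.2 : ℝ)) (lift z')
    _ ≤ L * phaseDist z z' := by
        gcongr
        exact norm_sub_le_phaseDist hn

theorem continuous_comp_lift {B L : ℝ≥0} {f : Cover d → ℝ} (hf : IsBL (periods d) B L f) :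
    Continuous fun z => f (lift z) := by
  refine continuous_iff_continuousAt.2 fun z => tendsto_iff_dist_tendsto_zero.2 ?_
  refine squeeze_zero (fun _ => dist_nonneg) (fun z' => abs_lift_sub_le hf z' z) ?_
  have hc : Continuous fun z' => L * phaseDist z' z := by
    unfold phaseDist
    fun_prop
  simpa [phaseDist] using hc.tendsto z

theorem integral_map_lift {W : Type*} [NormedAddCommGroup W] [NormedSpace ℝ W] {f : Cover d → W}
    (hf : Continuous f) (μ : Measure (Phase d)) :
    ∫ q, f q ∂(μ.map lift) = ∫ z, f (lift z) ∂μ :=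
  integral_map measurable_lift.aemeasurable hf.aestronglyMeasurable

end Cover

section Truncation

open ContinuousLinearMap (fst snd)

variable {d : ℕ} {P θm θM : ℝ}

/-- The velocities and temperatures of the points of `box d P θm θM`. -/
def slab (d : ℕ) (P θm θM : ℝ) : Set (EuclideanSpace ℝ (Fin d) × ℝ) :=
  Metric.closedBall 0 P ×ˢ Icc θm θM

theorem isCompact_slab : IsCompact (slab d P θm θM) :=
  (isCompact_closedBall 0 P).prod isCompact_Icc

theorem snd_lift_mem_slab {z : Phase d} : (lift z).2 ∈ slab d P θm θM ↔ z ∈ box d P θm θM :=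
  Iff.rfl

theorem slab_subset (hθm : 0 < θm) : slab d P θm θM ⊆ univ ×ˢ Ioi 0 :=
  fun _ hq => ⟨mem_univ _, hθm.trans_le hq.2.1⟩

/-- The velocity, the quotient of velocity and temperature, and the inverse temperature: the
functions of `(v, θ)` entering the equation. -/
noncomputable def thermo (q : EuclideanSpace ℝ (Fin d) × ℝ) : Cover d :=
  (q.1, q.2⁻¹ • q.1, q.2⁻¹)

theorem exists_bddLip_eqOn_thermo (hθm : 0 < θm) :
    ∃ ψ : EuclideanSpace ℝ (Fin d) × ℝ → Cover d,
      BddLip {0} ψ ∧ EqOn ψ thermo (slab d P θm θM) := by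
  refine exists_bddLip_eqOn isCompact_slab (isOpen_univ.prod isOpen_Ioi) (slab_subset hθm) ?_
  have hinv : ContDiffOn ℝ 1 (fun q : EuclideanSpace ℝ (Fin d) × ℝ => q.2⁻¹) (univ ×ˢ Ioi 0) :=
    contDiffOn_snd.inv fun q hq => ne_of_gt hq.2
  exact contDiffOn_fst.prodMk ((hinv.smul contDiffOn_fst).prodMk hinv)

variable {φ ζ : UnitAddTorus (Fin d) → ℝ} {ψ : EuclideanSpace ℝ (Fin d) × ℝ → Cover d}

/-- The free transport of the equation, with the truncation `ψ` in place of `thermo`. -/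
def drift (ψ : EuclideanSpace ℝ (Fin d) × ℝ → Cover d) (z : Cover d) : Cover d :=
  ((ψ z.2).1, 0, 0)

/-- The integrands of `F` and `G`, with the truncation `ψ` in place of `thermo`. -/
def interaction (φ ζ : UnitAddTorus (Fin d) → ℝ) (ψ : EuclideanSpace ℝ (Fin d) × ℝ → Cover d)
    (z w : Cover d) : Cover d :=
  (0, φ (toTorus (z.1 - w.1)) • ((ψ w.2).2.1 - (ψ z.2).2.1),
    ζ (toTorus (z.1 - w.1)) • ((ψ z.2).2.2 - (ψ w.2).2.2))

theorem bddLip_drift (hψ : BddLip {0} ψ) : BddLip (periods d) (drift ψ) :=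
  ((hψ.comp_clm (Λ' := periods d) (snd ℝ _ _) fun _ hp => hp.2).clm_comp (fst ℝ _ _)).prodMk
    (bddLip_const 0)

theorem bddLip_interaction (hφ : ∃ K : ℝ≥0, LipschitzWith K φ)
    (hζ : ∃ K : ℝ≥0, LipschitzWith K ζ) (hψ : BddLip {0} ψ) :
    BddLip (periods d ×ˢ periods d) fun q => interaction φ ζ ψ q.1 q.2 := by
  obtain ⟨Kφ, hφ⟩ := hφ
  obtain ⟨Kζ, hζ⟩ := hζ
  have hψ₁ : BddLip (periods d ×ˢ periods d) fun q : Cover d × Cover d => ψ q.1.2 :=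
    hψ.comp_clm ((snd ℝ _ _).comp (fst ℝ (Cover d) (Cover d))) fun _ hp => hp.1.2
  have hψ₂ : BddLip (periods d ×ˢ periods d) fun q : Cover d × Cover d => ψ q.2.2 :=
    hψ.comp_clm ((snd ℝ _ _).comp (snd ℝ (Cover d) (Cover d))) fun _ hp => hp.2.2
  let displacement : Cover d × Cover d →L[ℝ] EuclideanSpace ℝ (Fin d) :=
    (fst ℝ _ _).comp (fst ℝ _ _ - snd ℝ _ _)
  have mapsTo : MapsTo displacement (periods d ×ˢ periods d) (torusPeriods d) := fun p hp =>
    (toTorus_sub p.1.1 p.2.1).trans (sub_eq_zero.2 (hp.1.1.trans (Eq.symm hp.2.1)))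
  have hφd := (BddLip.comp_toTorus hφ).comp_clm displacement mapsTo
  have hζd := (BddLip.comp_toTorus hζ).comp_clm displacement mapsTo
  refine (bddLip_const 0).prodMk (.prodMk ?_ ?_)
  · exact hφd.smul ((hψ₂.sub hψ₁).clm_comp ((fst ℝ _ _).comp (snd ℝ _ _)))
  · exact hζd.smul ((hψ₁.sub hψ₂).clm_comp ((snd ℝ _ _).comp (snd ℝ _ _)))

theorem exists_isKernel (hφ : ∃ K : ℝ≥0, LipschitzWith K φ) (hζ : ∃ K : ℝ≥0, LipschitzWith K ζ)
    (hψ : BddLip {0} ψ) : ∃ B L, IsKernel (periods d) B L (drift ψ) (interaction φ ζ ψ) :=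
  (bddLip_drift hψ).exists_isKernel zero_mem_periods (bddLip_interaction hφ hζ hψ)

theorem interaction_lift (hψ : EqOn ψ thermo (slab d P θm θM)) {z w : Phase d}
    (hz : z ∈ box d P θm θM) (hw : w ∈ box d P θm θM) :
    interaction φ ζ ψ (lift z) (lift w)
      = (0, φ (z.1 - w.1) • ((w.2.2 : ℝ)⁻¹ • w.2.1 - (z.2.2 : ℝ)⁻¹ • z.2.1),
        ζ (z.1 - w.1) * ((z.2.2 : ℝ)⁻¹ - (w.2.2 : ℝ)⁻¹)) := by
  simp only [interaction, hψ (snd_lift_mem_slab.2 hz), hψ (snd_lift_mem_slab.2 hw), toTorus_sub]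
  simp [lift, thermo]

theorem field_lift {B L : ℝ≥0} (hk : IsKernel (periods d) B L (drift ψ) (interaction φ ζ ψ))
    (hψ : EqOn ψ thermo (slab d P θm θM)) {μ : Measure (Phase d)} [IsFiniteMeasure μ]
    (hμ : ∀ᵐ w ∂μ, w ∈ box d P θm θM) {z : Phase d} (hz : z ∈ box d P θm θM) :
    field (drift ψ) (interaction φ ζ ψ) (μ.map lift) (lift z)
      = (z.2.1, force φ μ z, heating ζ μ z) := by
  have hdrift : drift ψ (lift z) = (z.2.1, 0, 0) := by
    rw [drift, hψ (snd_lift_mem_slab.2 hz)]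
    rfl
  have integrable : Integrable (fun w => interaction φ ζ ψ (lift z) (lift w)) μ :=
    ((hk.right (lift z)).integrable (μ.map lift)).comp_measurable measurable_lift
  have ae_eq := hμ.mono fun w hw => interaction_lift (φ := φ) (ζ := ζ) hψ hz hw
  have hinteraction : ∫ w, interaction φ ζ ψ (lift z) w ∂(μ.map lift)
      = (0, force φ μ z, heating ζ μ z) := by
    rw [integral_map_lift (hk.right _).continuous]
    refine Prod.ext ?_ (Prod.ext ?_ ?_)
    · rw [fst_integral integrable]
      exact (integral_congr_ae (ae_eq.mono fun w hw => congrArg Prod.fst hw)).trans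
        (integral_zero _ _)
    · rw [snd_integral integrable, fst_integral integrable.snd]
      exact integral_congr_ae (ae_eq.mono fun w hw => congrArg (·.2.1) hw)
    · rw [snd_integral integrable, snd_integral integrable.snd]
      exact integral_congr_ae (ae_eq.mono fun w hw => congrArg (·.2.2) hw)
  rw [field, hdrift, hinteraction]
  simp

end Truncation

section TestFunctions

variable {d : ℕ} {P θm θM T t s : ℝ} {g : ℝ → Phase d → ℝ} {z : Phase d}

theorem inCoords_apply (g : ℝ → Phase d → ℝ) (s : ℝ) (y : EuclideanSpace ℝ (Fin d))
    (q : EuclideanSpace ℝ (Fin d) × Ioi (0 : ℝ)) :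
    inCoords g (s, y, q.1, q.2) = g s (toTorus y, q) := dif_pos q.2.2

theorem inCoords_lift (g : ℝ → Phase d → ℝ) (s : ℝ) (z : Phase d) :
    inCoords g (s, lift z) = g s z := by
  rw [lift, inCoords_apply, toTorus_torusSec]

section ChainRule

variable {ℓ : ℝ × Cover d →L[ℝ] ℝ}

theorem dTime_eq (h : HasFDerivAt (inCoords g) ℓ (s, lift z)) : dTime g s z = ℓ (1, 0) := by
  have line : HasDerivAt (fun r => (r, lift z)) (1, 0) s :=
    (hasDerivAt_id s).prodMk (hasDerivAt_const s _)
  rw [dTime, ← (h.comp_hasDerivAt s line).deriv]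
  simp only [Function.comp_def, inCoords_lift]

theorem inner_gradPos (h : HasFDerivAt (inCoords g) ℓ (s, lift z))
    (u : EuclideanSpace ℝ (Fin d)) : inner ℝ u (gradPos g s z) = ℓ (0, u, 0) := by
  have line : HasFDerivAt (fun y => (s, torusSec z.1 + y, (lift z).2))
      (ContinuousLinearMap.prod 0 (.prod (.id ℝ _) 0)) 0 :=
    (hasFDerivAt_const _ _).prodMk (((hasFDerivAt_id _).const_add _).prodMk (hasFDerivAt_const _ _))
  have coords : (fun y => g s (z.1 + toTorus y, z.2))
      = inCoords g ∘ fun y => (s, torusSec z.1 + y, (lift z).2) := by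
    ext y
    simp [lift, inCoords_apply, toTorus_add]
  have hz : HasFDerivAt (inCoords g) ℓ (s, torusSec z.1 + 0, (lift z).2) := by
    rw [add_zero]
    exact h
  rw [gradPos, real_inner_comm, inner_gradient_left, coords, (HasFDerivAt.comp 0 hz line).fderiv]
  rfl

theorem inner_gradVel (h : HasFDerivAt (inCoords g) ℓ (s, lift z))
    (v : EuclideanSpace ℝ (Fin d)) : inner ℝ v (gradVel g s z) = ℓ (0, 0, v, 0) := by
  have line : HasFDerivAt (fun w => (s, torusSec z.1, w, (z.2.2 : ℝ)))
      (ContinuousLinearMap.prod 0 (.prod 0 (.prod (.id ℝ _) 0))) z.2.1 :=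
    (hasFDerivAt_const _ _).prodMk <| (hasFDerivAt_const _ _).prodMk <|
      (hasFDerivAt_id _).prodMk (hasFDerivAt_const _ _)
  have coords : (fun w => g s (z.1, w, z.2.2))
      = inCoords g ∘ fun w => (s, torusSec z.1, w, (z.2.2 : ℝ)) := by
    ext w
    simpa using (inCoords_apply g s (torusSec z.1) (w, z.2.2)).symm
  rw [gradVel, real_inner_comm, inner_gradient_left, coords, (HasFDerivAt.comp z.2.1 h line).fderiv]
  rfl

theorem dTemp_eq (h : HasFDerivAt (inCoords g) ℓ (s, lift z)) :
    dTemp g s z = ℓ (0, 0, 0, 1) := by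
  have line : HasDerivAt (fun r => (s, torusSec z.1, z.2.1, r)) (0, 0, 0, 1) (z.2.2 : ℝ) :=
    (hasDerivAt_const _ _).prodMk <| (hasDerivAt_const _ _).prodMk <|
      (hasDerivAt_const _ _).prodMk (hasDerivAt_id _)
  rw [dTemp, ← (HasFDerivAt.comp_hasDerivAt (z.2.2 : ℝ) h line).deriv]
  simp only [Function.comp_def, inCoords, toTorus_torusSec]

theorem generator_eq (h : HasFDerivAt (inCoords g) ℓ (s, lift z))
    (u v : EuclideanSpace ℝ (Fin d)) (c : ℝ) :
    dTime g s z + inner ℝ u (gradPos g s z) + inner ℝ v (gradVel g s z) + c * dTemp g s z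
      = ℓ (1, u, v, c) := by
  rw [dTime_eq h, inner_gradPos h, inner_gradVel h, dTemp_eq h, ← smul_eq_mul c, ← map_smul,
    ← map_add, ← map_add, ← map_add]
  simp

end ChainRule

theorem isCompact_preimage_snd_lift {K : Set (EuclideanSpace ℝ (Fin d) × ℝ)} (hK : IsCompact K)
    (hpos : K ⊆ univ ×ˢ Ioi 0) : IsCompact ((fun z : Phase d => (lift z).2) ⁻¹' K) := by
  have inducing : Topology.IsInducing
      (Prod.map id Subtype.val : EuclideanSpace ℝ (Fin d) × Ioi (0 : ℝ) → _) :=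
    .prodMap .id .subtypeVal
  refine isProperMap_snd_of_compactSpace.isCompact_preimage (inducing.isCompact_preimage' hK ?_)
  exact fun q hq => ⟨(q.1, ⟨q.2, (hpos hq).2⟩), rfl⟩

theorem isCompact_box (hθm : 0 < θm) : IsCompact (box d P θm θM) :=
  isCompact_preimage_snd_lift isCompact_slab (slab_subset hθm)

theorem isTest_of_cutoff {χ : ℝ × EuclideanSpace ℝ (Fin d) × ℝ → ℝ} (hχ : ContDiff ℝ 1 χ)
    (compact : HasCompactSupport χ) (subset : tsupport χ ⊆ Iio T ×ˢ univ ×ˢ Ioi 0)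
    (hg : ContDiffOn ℝ 1 (inCoords g) {q | 0 < q.2.2.2}) :
    IsTest T fun s z => χ (s, (lift z).2) * g s z := by
  have hsub : Function.support (Function.uncurry fun s z => χ (s, (lift z).2) * g s z) ⊆
      (Prod.fst '' tsupport χ) ×ˢ ((fun z => (lift z).2) ⁻¹' (Prod.snd '' tsupport χ)) := by
    rintro ⟨s, z⟩ hsz
    have hmem : (s, (lift z).2) ∈ tsupport χ := subset_tsupport _ (left_ne_zero_of_mul hsz)
    exact ⟨mem_image_of_mem Prod.fst hmem, mem_image_of_mem Prod.snd hmem⟩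
  have hK : IsCompact ((Prod.fst '' tsupport χ) ×ˢ
      ((fun z : Phase d => (lift z).2) ⁻¹' (Prod.snd '' tsupport χ))) :=
    (compact.isCompact.image continuous_fst).prod <|
      isCompact_preimage_snd_lift (compact.isCompact.image continuous_snd) <|
        image_subset_iff.2 fun q hq => (subset hq).2
  refine ⟨?_, .of_support_subset_isCompact hK hsub, ?_⟩
  · refine ((hχ.comp (f := fun q : ℝ × Cover d => (q.1, q.2.2)) (by fun_prop)).contDiffOn.mul
      hg).congr fun q hq => ?_
    have hq : 0 < q.2.2.2 := hq
    simp [inCoords, hq, lift]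
  · refine (closure_minimal hsub hK.isClosed).trans (prod_mono ?_ (subset_univ _))
    exact image_subset_iff.2 fun q hq => (subset hq).1

theorem exists_isTest_eventuallyEq (hθm : 0 < θm) (ht : t < T) {f : Cover d → ℝ}
    (hf : ContDiff ℝ 1 f) (periodic : ∀ p ∈ periods d, Function.Periodic f p) :
    ∃ g, IsTest T g ∧ ∀ s ∈ Icc 0 t, ∀ z ∈ box d P θm θM,
      inCoords g =ᶠ[𝓝 (s, lift z)] fun q => f q.2 := by
  obtain ⟨χ, hχ, compact, subset, one⟩ := exists_contDiff_eventuallyEq_one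
    (isCompact_Icc.prod isCompact_slab) (isOpen_Iio.prod (isOpen_univ.prod isOpen_Ioi))
    (prod_mono (fun s (hs : s ∈ Icc 0 t) => hs.2.trans_lt ht) (slab_subset hθm))
  have coords {q : ℝ × Cover d} (hq : 0 < q.2.2.2) :
      inCoords (fun _ z => f (lift z)) q = f q.2 := by
    simp only [inCoords, hq, dif_pos]
    exact eq_of_toTorus_eq periodic (toTorus_torusSec _) _
  refine ⟨_, isTest_of_cutoff hχ compact subset
    ((hf.comp contDiff_snd).contDiffOn.congr fun q => coords), fun s hs z hz => ?_⟩
  have hproj : Tendsto (fun q : ℝ × Cover d => (q.1, q.2.2)) (𝓝 (s, lift z))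
      (𝓝 (s, (lift z).2)) :=
    Continuous.tendsto (by fun_prop) (s, lift z)
  have hpos : ∀ᶠ q : ℝ × Cover d in 𝓝 (s, lift z), 0 < q.2.2.2 :=
    continuousAt_const.eventually_lt (by fun_prop) z.2.2.2
  filter_upwards [hproj.eventually (one (s, (lift z).2) ⟨hs, hz⟩), hpos] with q hq hpos
  have hq : χ (q.1, q.2.2) = 1 := hq
  rw [← coords hpos]
  simp [inCoords, hpos, lift, hq]

end TestFunctions

section Solutions

variable {d : ℕ} {P θm θM T t : ℝ} {φ ζ : UnitAddTorus (Fin d) → ℝ}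

theorem ae_mem_box {μ : Measure (Phase d)} (h : μ.support ⊆ box d P θm θM) :
    ∀ᵐ z ∂μ, z ∈ box d P θm θM :=
  measure_mono_null (compl_subset_compl.2 h) Measure.measure_compl_support

theorem isFiniteMeasure_of_support_subset {μ : Measure (Phase d)} [μ.Regular] (hθm : 0 < θm)
    (h : μ.support ⊆ box d P θm θM) : IsFiniteMeasure μ := by
  refine ⟨?_⟩
  rw [← Measure.restrict_eq_self_of_ae_mem (ae_mem_box h), Measure.restrict_apply_univ]
  exact (isCompact_box hθm).measure_lt_top

theorem integral_fderiv_field_lift {B L B' L' A : ℝ≥0} {f : Cover d → ℝ}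
    {ψ : EuclideanSpace ℝ (Fin d) × ℝ → Cover d} (hf : IsC11 (periods d) B' L' A f)
    (hk : IsKernel (periods d) B L (drift ψ) (interaction φ ζ ψ))
    (hψ : EqOn ψ thermo (slab d P θm θM)) {μ : Measure (Phase d)} [IsFiniteMeasure μ]
    (hμ : ∀ᵐ z ∂μ, z ∈ box d P θm θM) :
    rate (drift ψ) (interaction φ ζ ψ) (μ.map lift) f
      = ∫ z, fderiv ℝ f (lift z) (z.2.1, force φ μ z, heating ζ μ z) ∂μ := by
  have hcont : Continuous fun q =>
      fderiv ℝ f q (field (drift ψ) (interaction φ ζ ψ) (μ.map lift) q) :=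
    hf.isBL_fderiv.continuous.clm_apply
      (hk.isBL_field (M := ((μ.map lift).real univ).toNNReal) (Real.le_coe_toNNReal _)).continuous
  rw [rate, integral_map_lift hcont]
  exact integral_congr_ae (hμ.mono fun z hz => by simp only [field_lift hk hψ hμ hz])

variable {μ : ℝ → Measure (Phase d)}

namespace IsMeasureValuedSolution

theorem isFiniteMeasure (hμ : IsMeasureValuedSolution φ ζ T μ) (hθm : 0 < θm)
    (hs : ∀ t ∈ Icc 0 T, (μ t).support ⊆ box d P θm θM) (ht : t ∈ Icc 0 T) :
    IsFiniteMeasure (μ t) :=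
  have := hμ.radon t ht
  isFiniteMeasure_of_support_subset hθm (hs t ht)

theorem continuousOn_lift (hμ : IsMeasureValuedSolution φ ζ T μ) (hθm : 0 < θm)
    (hs : ∀ t ∈ Icc 0 T, (μ t).support ⊆ box d P θm θM) {B L : ℝ≥0} {f : Cover d → ℝ}
    (hf : IsBL (periods d) B L f) :
    ContinuousOn (fun t => ∫ z, f (lift z) ∂(μ t)) (Icc 0 T) := by
  obtain ⟨χ, hχ, compact, subset, one⟩ := exists_contDiff_eventuallyEq_one
    (isCompact_slab (d := d) (P := P) (θM := θM)) (isOpen_univ.prod isOpen_Ioi) (slab_subset hθm)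
  have continuous : Continuous fun z : Phase d => χ (lift z).2 * f (lift z) :=
    (hχ.continuous.comp continuous_snd_lift).mul (continuous_comp_lift hf)
  have compactSupport : HasCompactSupport fun z : Phase d => χ (lift z).2 * f (lift z) :=
    .of_support_subset_isCompact (isCompact_preimage_snd_lift compact.isCompact subset)
      fun z hz => subset_tsupport χ (left_ne_zero_of_mul hz)
  refine (hμ.weaklyContinuous ⟨⟨_, continuous⟩, compactSupport.is_zero_at_infty⟩).congr
    fun t ht => integral_congr_ae ((ae_mem_box (hs t ht)).mono fun z hz => ?_)
  simp [(one _ (snd_lift_mem_slab.2 hz)).self_of_nhds]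

theorem integral_lift_sub (hμ : IsMeasureValuedSolution φ ζ T μ) (hθm : 0 < θm)
    (hs : ∀ t ∈ Icc 0 T, (μ t).support ⊆ box d P θm θM) {f : Cover d → ℝ} (hf : ContDiff ℝ 1 f)
    (periodic : ∀ p ∈ periods d, Function.Periodic f p) (ht : t ∈ Ico 0 T) :
    ∫ z, f (lift z) ∂(μ t) - ∫ z, f (lift z) ∂(μ 0)
      = ∫ s in (0 : ℝ)..t, ∫ z,
          fderiv ℝ f (lift z) (z.2.1, force φ (μ s) z, heating ζ (μ s) z) ∂(μ s) := by
  obtain ⟨g, test, hg⟩ := exists_isTest_eventuallyEq (P := P) (θM := θM) hθm ht.2 hf periodic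
  have ae_mem {s : ℝ} (h : s ∈ Icc 0 t) : ∀ᵐ z ∂(μ s), z ∈ box d P θm θM :=
    ae_mem_box (hs s ⟨h.1, h.2.trans ht.2.le⟩)
  have value {s : ℝ} (h : s ∈ Icc 0 t) : ∫ z, g s z ∂(μ s) = ∫ z, f (lift z) ∂(μ s) :=
    integral_congr_ae <| (ae_mem h).mono fun z hz =>
      (inCoords_lift g s z).symm.trans (hg s h z hz).self_of_nhds
  rw [← value ⟨ht.1, le_rfl⟩, ← value ⟨le_rfl, ht.1⟩, hμ.equation g test t ht]
  refine intervalIntegral.integral_congr fun s h => ?_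
  rw [uIcc_of_le ht.1] at h
  refine integral_congr_ae ((ae_mem h).mono fun z hz => ?_)
  have hfz : HasFDerivAt f (fderiv ℝ f (lift z)) (lift z) :=
    (hf.differentiable one_ne_zero _).hasFDerivAt
  exact generator_eq ((hfz.comp (s, lift z) hasFDerivAt_snd).congr_of_eventuallyEq (hg s h z hz))
    _ _ _

theorem real_univ_eq (hμ : IsMeasureValuedSolution φ ζ T μ) (hθm : 0 < θm)
    (hs : ∀ t ∈ Icc 0 T, (μ t).support ⊆ box d P θm θM) (hT : 0 < T) (ht : t ∈ Icc 0 T) :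
    (μ t).real univ = (μ 0).real univ := by
  have continuousOn : ContinuousOn (fun t => (μ t).real univ) (Icc 0 T) := by
    simpa using hμ.continuousOn_lift hθm hs (isC11_const (1 : ℝ)).toIsBL
  have conserved : EqOn (fun t => (μ t).real univ) (fun _ => (μ 0).real univ) (Ico 0 T) :=
    fun t ht => sub_eq_zero.1 <| by
      simpa using hμ.integral_lift_sub hθm hs (f := 1) contDiff_const (fun p _ q => rfl) ht
  exact conserved.of_subset_closure continuousOn continuousOn_const Ico_subset_Icc_self
    (closure_Ico hT.ne).ge ht

theorem isWeakSol (hμ : IsMeasureValuedSolution φ ζ T μ) (hθm : 0 < θm) (hT : 0 < T)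
    (hs : ∀ t ∈ Icc 0 T, (μ t).support ⊆ box d P θm θM) {M B L : ℝ≥0} (hM : μ 0 univ ≤ M)
    {ψ : EuclideanSpace ℝ (Fin d) × ℝ → Cover d} (hψ : EqOn ψ thermo (slab d P θm θM))
    (hk : IsKernel (periods d) B L (drift ψ) (interaction φ ζ ψ)) :
    IsWeakSol (periods d) (drift ψ) (interaction φ ζ ψ) M T fun t => (μ t).map lift where
  measure_univ_le t ht := by
    have := hμ.isFiniteMeasure hθm hs ht
    have := hμ.isFiniteMeasure hθm hs ⟨le_rfl, hT.le⟩
    rw [Measure.map_apply measurable_lift .univ, preimage_univ]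
    exact ((measureReal_eq_measureReal_iff).1 (hμ.real_univ_eq hθm hs hT ht)).trans_le hM
  tight := by
    refine ⟨Metric.closedBall 0 (Real.sqrt d) ×ˢ slab d P θm θM,
      (isCompact_closedBall 0 _).prod isCompact_slab, fun t ht => ?_⟩
    rw [← mem_ae_iff]
    refine (ae_map_iff measurable_lift.aemeasurable
      ((isCompact_closedBall 0 _).prod isCompact_slab).measurableSet).2 ?_
    exact (ae_mem_box (hs t ht)).mono fun z hz =>
      ⟨mem_closedBall_zero_iff.2 (norm_torusSec_le z.1), snd_lift_mem_slab.2 hz⟩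
  continuousOn hf := by
    simpa only [integral_map_lift hf.continuous] using hμ.continuousOn_lift hθm hs hf
  equation {_ _ _ f} hf t ht := by
    rw [integral_map_lift hf.continuous, integral_map_lift hf.continuous,
      hμ.integral_lift_sub hθm hs hf.contDiff hf.periodic ht]
    refine intervalIntegral.integral_congr fun s h => ?_
    rw [uIcc_of_le ht.1] at h
    have hsT : s ∈ Icc 0 T := ⟨h.1, h.2.trans ht.2.le⟩
    have := hμ.isFiniteMeasure hθm hs hsT
    exact (integral_fderiv_field_lift hf hk hψ (ae_mem_box (hs s hsT))).symm

end IsMeasureValuedSolution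

end Solutions

section Comparison

variable {d : ℕ} {P θm θM : ℝ}

theorem ofReal_dualDist_map_lift_le (μ ν : Measure (Phase d)) :
    ENNReal.ofReal (dualDist (blBall (periods d)) (μ.map lift) (ν.map lift)) ≤ blDist μ ν := by
  rcases eq_or_ne (blDist μ ν) ⊤ with htop | hfin
  · simp [htop]
  refine ENNReal.ofReal_le_of_le_toReal
    (dualDist_le ENNReal.toReal_nonneg fun f (hf : IsBL _ 1 1 f) => ?_)
  rw [integral_map_lift hf.continuous, integral_map_lift hf.continuous]
  refine (ENNReal.ofReal_le_iff_le_toReal hfin).1 <| le_iSup₂_of_le (fun z => f (lift z)) ?_ le_rfl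
  exact ⟨fun z => hf.norm_le _, fun z z' => by simpa using abs_lift_sub_le hf z z'⟩

/-- The point of the phase space over a point of the cover, with the temperature raised to at
least `θm`. -/
def proj (hθm : 0 < θm) (q : Cover d) : Phase d :=
  (toTorus q.1, q.2.1, ⟨max q.2.2 θm, hθm.trans_le (le_max_right _ _)⟩)

theorem proj_lift (hθm : 0 < θm) {z : Phase d} (hz : z ∈ box d P θm θM) :
    proj hθm (lift z) = z :=
  Prod.ext (toTorus_torusSec _) (Prod.ext rfl (Subtype.ext (max_eq_left hz.2.1)))

theorem phaseDist_proj_le (hθm : 0 < θm) (q q' : Cover d) :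
    phaseDist (proj hθm q) (proj hθm q') ≤ 2 * ‖q - q'‖ := by
  have position : ∑ i, ‖toTorus q.1 i - toTorus q'.1 i‖ ^ 2 ≤ ‖q - q'‖ ^ 2 :=
    (sum_norm_toTorus_sub_sq_le _ _).trans (by gcongr; exact norm_fst_le (q - q'))
  have velocity : ‖q.2.1 - q'.2.1‖ ^ 2 ≤ ‖q - q'‖ ^ 2 := by
    gcongr
    exact (norm_fst_le (q - q').2).trans (norm_snd_le (q - q'))
  have temperature : (max q.2.2 θm - max q'.2.2 θm) ^ 2 ≤ ‖q - q'‖ ^ 2 := by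
    rw [← sq_abs]
    gcongr
    exact (abs_max_sub_max_le_abs _ _ _).trans
      ((norm_snd_le (q - q').2).trans (norm_snd_le (q - q')))
  refine Real.sqrt_le_iff.2 ⟨by positivity, ?_⟩
  simp only [proj]
  linarith [sq_nonneg ‖q - q'‖]

theorem isBL_comp_proj (hθm : 0 < θm) {g : Phase d → ℝ} (hg : g ∈ blClass d) :
    IsBL (periods d) 1 2 fun q => g (proj hθm q) where
  norm_le q := hg.1 _
  lipschitz := .of_dist_le_mul fun q q' => by
    rw [dist_eq_norm q]
    exact (hg.2 _ _).trans (phaseDist_proj_le hθm q q')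
  periodic p hp q := by
    have hpos : toTorus (q.1 + p.1) = toTorus q.1 := by
      rw [toTorus_add, show toTorus p.1 = 0 from hp.1, add_zero]
    have hvel : p.2 = 0 := hp.2
    simp [proj, hpos, hvel]

theorem blDist_le_of_ae_mem_box (hθm : 0 < θm) {μ ν : Measure (Phase d)} [IsFiniteMeasure μ]
    [IsFiniteMeasure ν] (hμ : ∀ᵐ z ∂μ, z ∈ box d P θm θM) (hν : ∀ᵐ z ∂ν, z ∈ box d P θm θM) :
    blDist μ ν ≤
      ENNReal.ofReal (3 * dualDist (blBall (periods d)) (μ.map lift) (ν.map lift)) := by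
  refine iSup₂_le fun g hg => ENNReal.ofReal_le_ofReal ?_
  have hf := isBL_comp_proj hθm hg
  have pullback {m : Measure (Phase d)} (hm : ∀ᵐ z ∂m, z ∈ box d P θm θM) :
      ∫ q, g (proj hθm q) ∂(m.map lift) = ∫ z, g z ∂m := by
    rw [integral_map_lift hf.continuous]
    exact integral_congr_ae (hm.mono fun z hz => congrArg g (proj_lift hθm hz))
  calc |∫ z, g z ∂μ - ∫ z, g z ∂ν|
      ≤ (1 + 2) * dualDist (blBall (periods d)) (μ.map lift) (ν.map lift) := by
        rw [← pullback hμ, ← pullback hν]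
        exact hf.abs_integral_sub_le
    _ = 3 * dualDist (blBall (periods d)) (μ.map lift) (ν.map lift) := by norm_num

end Comparison

end TCS

/-- Stability of measure-valued solutions in the bounded Lipschitz distance. The constant depends
only on the kernels, `T`, the support bounds and a bound `M` for the total masses of the initial
measures (which are finite, being Radon with compact support). -/
theorem proposition3p1 (d : ℕ) (φ ζ : UnitAddTorus (Fin d) → ℝ)
    (hφ : ∃ K : ℝ≥0, LipschitzWith K φ) (hζ : ∃ K : ℝ≥0, LipschitzWith K ζ)
    (T P θm θM : ℝ) (hT : 0 < T) (hP : 0 < P) (hθm : 0 < θm) (hθM : 0 < θM) (M : ℝ≥0) :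
    ∃ C : ℝ, 0 < C ∧ ∀ μ ν : ℝ → Measure (TCS.Phase d),
      TCS.IsMeasureValuedSolution φ ζ T μ → TCS.IsMeasureValuedSolution φ ζ T ν →
      (∀ t ∈ Icc 0 T, (μ t).support ⊆ TCS.box d P θm θM) →
      (∀ t ∈ Icc 0 T, (ν t).support ⊆ TCS.box d P θm θM) →
      μ 0 univ ≤ M → ν 0 univ ≤ M →
      ∀ t ∈ Icc 0 T,
        TCS.blDist (μ t) (ν t) ≤ ENNReal.ofReal C * TCS.blDist (μ 0) (ν 0) := by
  obtain ⟨ψ, hψ, thermo⟩ := TCS.exists_bddLip_eqOn_thermo (d := d) (P := P) (θM := θM) hθm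
  obtain ⟨B, L, hk⟩ := TCS.exists_isKernel hφ hζ hψ
  set E := Real.exp (TCS.stabilityRate B L M * T)
  refine ⟨3 * E, by positivity, fun μ ν hμ hν hsμ hsν hMμ hMν t ht => ?_⟩
  have := hμ.isFiniteMeasure hθm hsμ ht
  have := hν.isFiniteMeasure hθm hsν ht
  let D (s : ℝ) := TCS.dualDist (TCS.blBall (TCS.periods d)) ((μ s).map TCS.lift)
    ((ν s).map TCS.lift)
  have stability : D t ≤ E * D 0 := (hμ.isWeakSol hθm hT hsμ hMμ thermo hk).stability
    (hν.isWeakSol hθm hT hsν hMν thermo hk) hk hT ht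
  calc TCS.blDist (μ t) (ν t)
      ≤ ENNReal.ofReal (3 * D t) :=
        TCS.blDist_le_of_ae_mem_box hθm (TCS.ae_mem_box (hsμ t ht)) (TCS.ae_mem_box (hsν t ht))
    _ ≤ ENNReal.ofReal (3 * E * D 0) := by
        rw [mul_assoc]
        gcongr
    _ = ENNReal.ofReal (3 * E) * ENNReal.ofReal (D 0) := ENNReal.ofReal_mul (by positivity)
    _ ≤ ENNReal.ofReal (3 * E) * TCS.blDist (μ 0) (ν 0) := by
        gcongr
        exact TCS.ofReal_dualDist_map_lift_le _ _
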